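/- Let $p_n$ be the $n$-th prime, and for $\alpha\in[0,1]$ and $N\ge 2$ let $$\delta_{\min}^{\alpha}(N)=\min\{\|(p_m-p_n)\alpha\| : 1\le m,n\le N,\ m\ne n\},$$ where $\|x\|$ denotes the distance from $x$ to the nearest integer. Let $(\eta(N))_{N\ge 1}$ be a strictly decreasing sequence of non-negative reals for which there is a constant $c>0$ with $\eta(2N)/\eta(N)\ge c$ for all integers $N\ge 1$. Extend $\eta$ to real arguments $x\ge 1$ by any non-increasing function on $[1,\infty)$ that agrees with the sequence at the integers (for instance $\eta(x)=\eta(\lfloor x\rfloor)$), and read $\log x$ as $\max\{1,\log x\}$. Let $\mathcal A$ be the set of those $\alpha\in[0,1]$ for which $$\delta_{\min}^{\alpha}(N)\le \eta(N\log N)$$ holds for infinitely many integers $N\geq 2$. Then $\mathcal A$ is measurable, and its Lebesgue measure is $\lambda(\mathcal A)=0$ if the series $\sum_{N=1}^\infty \eta(N)$ converges, and $\lambda(\mathcal A)=1$ if it diverges. -/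

import Mathlib

open MeasureTheory

/-- The `n`-th prime `p_n`, for `n ≥ 1`: `p_1 = 2`, `p_2 = 3`, ... -/
noncomputable def primeSeq (n : ℕ) : ℕ := Nat.nth Nat.Prime (n - 1)

/-- The minimal gap `min {‖(a_m - a_n) α‖ : 1 ≤ m, n ≤ N, m ≠ n}` of the points
`a_1 α, ..., a_N α` on the torus `ℝ / ℤ`, where `‖x‖` is the distance of `x` to the nearest
integer. For `N ≥ 2` the set is finite and non-empty, so that its infimum is a minimum. -/
noncomputable def minGap (a : ℕ → ℕ) (α : ℝ) (N : ℕ) : ℝ :=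
  sInf {d : ℝ | ∃ m n : ℕ, 1 ≤ m ∧ m ≤ N ∧ 1 ≤ n ∧ n ≤ N ∧ m ≠ n ∧
    d = ‖((((a m : ℝ) - (a n : ℝ)) * α : ℝ) : UnitAddCircle)‖}

/-- The logarithm with the convention that `log x` is read as `max {1, log x}`. -/
noncomputable def logOne (x : ℝ) : ℝ := max 1 (Real.log x)

/-- The set of those `α ∈ [0,1]` for which the minimal gap of the first `N` points of
`(p_n α)` is at most `η (N log N)` for infinitely many `N`. -/
def smallGapSet (η : ℝ → ℝ) : Set ℝ :=
  {α : ℝ | α ∈ Set.Icc (0 : ℝ) 1 ∧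
    {N : ℕ | minGap primeSeq α N ≤ η ((N : ℝ) * logOne (N : ℝ))}.Infinite}

/-! Everything reduces to approximation of zero by dα, where d runs over differences of primes,
because a prime difference available at stage N is at most p_N, which is of order N log N.

Convergence (`volume_smallGapSet_eq_zero`). If the gap at stage N is at most η(N log N), then some d
≤ p_N ≤ K N log N has ‖dα‖ ≤ η(N log N) ≤ η(d/K). Since x ↦ dx preserves Haar measure and ∑ η(d/K)
converges, Borel–Cantelli leaves only boundedly many d for almost every α. These are excluded for
large N because η tends to 0 and dα ≠ 0 on the circle almost surely.

Divergence (`volume_smallGapSet_eq_one`). Differences of primes have positive lower density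
(`exists_primeDifferences_density`): Selberg's sieve bounds the pairs n, n + d of primes with n < X
by a multiple of X (d/φ(d)) / log² X (`card_prime_pairs_le`), while Chebyshev supplies about (X /
log X)² pairs in total. So the sum of d/φ(d) over the differences that occur is at least a multiple
of X, and a second moment bound for d/φ(d) lets one keep only differences with d/φ(d) bounded. A
decreasing divergent series still diverges over such a set.

On these d the points within θ(d)/d of a point of exact order d form a set of measure comparable to
θ(d), and for d ≠ e the overlaps are at most 8 θ(d) θ(e). Hence the limsup set has positive measure,
and Gallagher's zero-one law makes it full (`ae_infinite_norm_nsmul_lt`). A difference d = q - p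
with q ≤ K d then yields a small gap at the index N of q, as N log N ≤ 5q. -/

/-! ### Sums of periodic functions. -/

open Finset in
theorem sum_range_mul_of_periodic {a b : ℕ} (hab : a.Coprime b) (ha : 0 < a) (hb : 0 < b)
    {f g : ℕ → ℝ} (hf : Function.Periodic f a) (hg : Function.Periodic g b) :
    ∑ n ∈ range (a * b), f n * g n = (∑ n ∈ range a, f n) * ∑ n ∈ range b, g n := by
  rw [sum_mul_sum, ← sum_product']
  refine sum_bij' (fun n _ => (n % a, n % b))
    (fun x _ => (Nat.chineseRemainder hab x.1 x.2 : ℕ)) ?_ ?_ ?_ ?_ ?_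
  · intro n _
    simp [Nat.mod_lt _ ha, Nat.mod_lt _ hb]
  · intro x _
    exact mem_range.2 (Nat.chineseRemainder_lt_mul hab _ _ ha.ne' hb.ne')
  · intro n hn
    have h1 := (Nat.chineseRemainder hab (n % a) (n % b)).2
    refine Nat.ModEq.eq_of_lt_of_lt (m := a * b) ?_
      (Nat.chineseRemainder_lt_mul hab _ _ ha.ne' hb.ne') (mem_range.1 hn)
    exact (Nat.modEq_and_modEq_iff_modEq_mul hab).1
      ⟨h1.1.trans (Nat.mod_modEq _ _), h1.2.trans (Nat.mod_modEq _ _)⟩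
  · intro x hx
    have h1 := (Nat.chineseRemainder hab x.1 x.2).2
    rw [mem_product, mem_range, mem_range] at hx
    ext
    · exact Eq.trans h1.1 (Nat.mod_eq_of_lt hx.1)
    · exact Eq.trans h1.2 (Nat.mod_eq_of_lt hx.2)
  · intro n _
    simp only
    rw [hf.map_mod_nat, hg.map_mod_nat]

-- By the Chinese remainder theorem the residues of n modulo distinct primes are independent over a
-- full period.
open Finset in
theorem sum_range_prod_of_periodic (T : Finset ℕ) (hT : ∀ p ∈ T, p.Prime) (u : ℕ → ℕ → ℝ)
    (hu : ∀ p ∈ T, Function.Periodic (u p) p) :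
    ∑ n ∈ range (∏ p ∈ T, p), ∏ p ∈ T, u p n = ∏ p ∈ T, ∑ n ∈ range p, u p n := by
  induction T using Finset.induction_on with
  | empty => simp
  | insert q T hq ih =>
    have hT' : ∀ p ∈ T, p.Prime := fun p hp => hT p (mem_insert_of_mem hp)
    have hu' : ∀ p ∈ T, Function.Periodic (u p) p := fun p hp => hu p (mem_insert_of_mem hp)
    rw [prod_insert hq, prod_insert hq, ← ih hT' hu', ← sum_range_mul_of_periodic]
    · exact sum_congr rfl fun n _ => prod_insert hq
    · exact Nat.Coprime.prod_right fun p hp => (Nat.coprime_primes (hT q (mem_insert_self _ _))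
        (hT' p hp)).2 fun h => hq (h ▸ hp)
    · exact (hT q (mem_insert_self _ _)).pos
    · exact prod_pos fun p hp => (hT' p hp).pos
    · exact hu q (mem_insert_self _ _)
    · intro n
      refine prod_congr rfl fun p hp => ?_
      obtain ⟨k, hk⟩ := dvd_prod_of_mem (fun p : ℕ => p) hp
      have h1 := (hu' p hp).nat_mul k
      rw [hk, mul_comm]
      exact h1 n

-- The range splits into ⌊X/L⌋ full periods and fewer than L further terms; `hs` allows the floor to
-- be replaced by X/L.
open Finset in
theorem sum_range_le_of_periodic {f : ℕ → ℝ} {L : ℕ} (hL : 0 < L) (hf : Function.Periodic f L)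
    {M : ℝ} (hM : ∀ n, |f n| ≤ M) (hs : 0 ≤ ∑ n ∈ range L, f n) (X : ℕ) :
    ∑ n ∈ range X, f n ≤ X / L * ∑ n ∈ range L, f n + L * M := by
  have key : ∀ q r : ℕ, ∑ n ∈ range (L * q + r), f n
      = q * ∑ n ∈ range L, f n + ∑ n ∈ range r, f n := by
    intro q r
    induction q with
    | zero => simp
    | succ q ih =>
      have : L * (q + 1) + r = L + (L * q + r) := by ring
      have hf' : ∀ n, f (L + n) = f n := fun n => by rw [add_comm L n, hf n]
      rw [this, sum_range_add, sum_congr rfl (fun n _ => hf' n), ih]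
      push_cast
      ring
  have h1 := key (X / L) (X % L)
  rw [Nat.div_add_mod] at h1
  rw [h1]
  have hM0 : 0 ≤ M := (abs_nonneg _).trans (hM 0)
  have h2 : ∑ n ∈ range (X % L), f n ≤ (L : ℝ) * M := by
    calc ∑ n ∈ range (X % L), f n ≤ ∑ _n ∈ range (X % L), M :=
          sum_le_sum fun n _ => (le_abs_self _).trans (hM n)
      _ = ((X % L : ℕ) : ℝ) * M := by simp
      _ ≤ _ := by gcongr; exact (Nat.mod_lt _ hL).le
  have h3 : ((X / L : ℕ) : ℝ) ≤ (X : ℝ) / L := Nat.cast_div_le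
  gcongr

/-! ### Selberg's sieve in dual form. -/

/-- The number of residues modulo `p` that satisfy `B p`. -/
noncomputable def residueCount (B : ℕ → ℕ → Prop) (p : ℕ) : ℕ :=
  open Classical in (Finset.filter (B p) (Finset.range p)).card

/-- The density `ρ / (p - ρ)` of Selberg's sieve, where `ρ` is the number of bad residues. -/
noncomputable def sieveDensity (B : ℕ → ℕ → Prop) (p : ℕ) : ℝ :=
  residueCount B p / (p - residueCount B p)

/-- The function of mean zero modulo `p` that is `1` at the residues outside `B p` and is
constant on the residues in `B p`. -/
noncomputable def sieveWeight (B : ℕ → ℕ → Prop) (p n : ℕ) : ℝ :=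
  open Classical in if B p n then -((p - residueCount B p) / residueCount B p) else 1

section Sieve

variable {B : ℕ → ℕ → Prop} {p : ℕ}

theorem sieveDensity_pos (h0 : 0 < residueCount B p) (h1 : residueCount B p < p) :
    0 < sieveDensity B p := by
  have : (residueCount B p : ℝ) < p := by exact_mod_cast h1
  exact div_pos (by exact_mod_cast h0) (by linarith)

theorem sum_sieveWeight (h0 : 0 < residueCount B p) :
    ∑ n ∈ Finset.range p, sieveWeight B p n = 0 := by
  classical
  have h0' : (residueCount B p : ℝ) ≠ 0 := by exact_mod_cast h0.ne'
  have hc := Finset.card_filter_add_card_filter_not (s := Finset.range p) (B p)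
  rw [Finset.card_range] at hc
  have hr : (Finset.filter (B p) (Finset.range p)).card = residueCount B p := by
    unfold residueCount; congr
  unfold sieveWeight
  rw [Finset.sum_ite, Finset.sum_const, Finset.sum_const]
  rw [hr] at hc ⊢
  have hc' : (residueCount B p : ℝ) + ((Finset.filter (fun n => ¬ B p n) (Finset.range p)).card : ℝ)
    = p := by exact_mod_cast hc
  rw [← hc']
  simp only [nsmul_eq_mul]
  field_simp
  ring

theorem sum_sieveWeight_sq (h0 : 0 < residueCount B p) (h1 : residueCount B p < p) :
    ∑ n ∈ Finset.range p, sieveWeight B p n * sieveWeight B p n = p / sieveDensity B p := by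
  classical
  have h0' : (residueCount B p : ℝ) ≠ 0 := by exact_mod_cast h0.ne'
  have h1' : (residueCount B p : ℝ) < p := by exact_mod_cast h1
  have hc := Finset.card_filter_add_card_filter_not (s := Finset.range p) (B p)
  rw [Finset.card_range] at hc
  have hr : (Finset.filter (B p) (Finset.range p)).card = residueCount B p := by
    unfold residueCount; congr
  unfold sieveWeight sieveDensity
  simp only [mul_ite, ite_mul, mul_one, one_mul]
  have : ∀ n, (if B p n then if B p n then -(((p : ℝ) - residueCount B p) / residueCount B p) *
      -(((p : ℝ) - residueCount B p) / residueCount B p)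
      else -(((p : ℝ) - residueCount B p) / residueCount B p) else
      if B p n then -(((p : ℝ) - residueCount B p) / residueCount B p) else 1) =
      if B p n then (((p : ℝ) - residueCount B p) / residueCount B p) ^ 2 else 1 := by
    intro n
    by_cases h : B p n
    · simp [h]; ring
    · simp [h]
  rw [Finset.sum_congr rfl fun n _ => this n]
  rw [Finset.sum_ite, Finset.sum_const, Finset.sum_const]
  rw [hr] at hc ⊢
  have hc' : (residueCount B p : ℝ) + ((Finset.filter (fun n => ¬ B p n) (Finset.range p)).card : ℝ)
    = p := by exact_mod_cast hc
  have h2 : ((Finset.filter (fun n => ¬ B p n) (Finset.range p)).card : ℝ)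
    = p - residueCount B p := by linarith
  have h3 : (p : ℝ) - residueCount B p ≠ 0 := by linarith
  simp only [nsmul_eq_mul]
  rw [h2]
  field_simp
  ring

theorem abs_sieveDensity_mul_sieveWeight_le (h0 : 0 < residueCount B p)
    (h1 : residueCount B p < p) (n : ℕ) : |sieveDensity B p * sieveWeight B p n| ≤ p := by
  have h0' : (0 : ℝ) < residueCount B p := by exact_mod_cast h0
  have h1' : (residueCount B p : ℝ) + 1 ≤ p := by exact_mod_cast h1
  have h2 : (1 : ℝ) ≤ p - residueCount B p := by linarith
  have h3 : (p : ℝ) - residueCount B p ≠ 0 := by linarith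
  unfold sieveWeight
  split_ifs
  · have : sieveDensity B p * -((p - residueCount B p) / residueCount B p) = -1 := by
      unfold sieveDensity
      field_simp
    rw [this]
    norm_num
    linarith
  · rw [mul_one, abs_of_pos (sieveDensity_pos h0 h1), sieveDensity, div_le_iff₀ (by linarith)]
    nlinarith

theorem sieveWeight_periodic (hB : Function.Periodic (B p) p) :
    Function.Periodic (sieveWeight B p) p := by
  intro n
  unfold sieveWeight
  rw [hB n]

open Finset in
/-- The weights attached to distinct sets of primes are orthogonal over a common period. -/
theorem sum_range_prod_sieveWeight (T T' : Finset ℕ) (hT : ∀ p ∈ T, p.Prime)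
    (hT' : ∀ p ∈ T', p.Prime) (hB : ∀ p, p.Prime → Function.Periodic (B p) p)
    (h0 : ∀ p, p.Prime → 0 < residueCount B p) (h1 : ∀ p, p.Prime → residueCount B p < p) :
    ∑ n ∈ range (∏ p ∈ T ∪ T', p),
      (∏ p ∈ T, sieveWeight B p n) * ∏ p ∈ T', sieveWeight B p n =
      if T = T' then (∏ p ∈ T, (p : ℝ)) / ∏ p ∈ T, sieveDensity B p else 0 := by
  classical
  have hU : ∀ p ∈ T ∪ T', p.Prime := by
    intro p hp
    rcases mem_union.1 hp with h | h
    exacts [hT p h, hT' p h]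
  have hsplit : ∀ n, (∏ p ∈ T, sieveWeight B p n) * ∏ p ∈ T', sieveWeight B p n =
      ∏ p ∈ T ∪ T', (if p ∈ T then sieveWeight B p n else 1) *
        (if p ∈ T' then sieveWeight B p n else 1) := by
    intro n
    rw [prod_mul_distrib, prod_ite_mem, prod_ite_mem, union_inter_cancel_left,
      union_inter_cancel_right]
  rw [sum_congr rfl fun n _ => hsplit n]
  rw [sum_range_prod_of_periodic (T ∪ T') hU (fun p n => (if p ∈ T then sieveWeight B p n else 1) *
        (if p ∈ T' then sieveWeight B p n else 1))]
  · split_ifs with h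
    · subst h
      rw [union_self, ← prod_div_distrib]
      refine prod_congr rfl fun p hp => ?_
      simp only [hp, if_true]
      exact sum_sieveWeight_sq (h0 p (hT p hp)) (h1 p (hT p hp))
    · have : ∃ p, (p ∈ T ∧ p ∉ T') ∨ (p ∉ T ∧ p ∈ T') := by
        by_contra! hne
        exact h (ext fun p => ⟨(hne p).1, fun hp => by_contra fun hq => (hne p).2 hq hp⟩)
      obtain ⟨p, hp⟩ := this
      refine prod_eq_zero (i := p) (mem_union.2 ?_) ?_
      · tauto
      · rcases hp with hp | hp
        · simp only [hp.1, hp.2, if_true, if_false, mul_one]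
          exact sum_sieveWeight (h0 p (hT p hp.1))
        · simp only [hp.1, hp.2, if_true, if_false, one_mul]
          exact sum_sieveWeight (h0 p (hT' p hp.2))
  · intro p hp n
    simp only [sieveWeight_periodic (hB p (hU p hp)) n]

open Finset in
/-- **Selberg's sieve**. -/
theorem card_mul_sq_le_of_sieve (𝒯 : Finset (Finset ℕ)) (z X : ℕ) (S : Finset ℕ)
    (hS : S ⊆ range X)
    (hT : ∀ T ∈ 𝒯, ∀ p ∈ T, p.Prime) (hz : ∀ T ∈ 𝒯, ∏ p ∈ T, p ≤ z)
    (hST : ∀ n ∈ S, ∀ T ∈ 𝒯, ∀ p ∈ T, ¬ B p n)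
    (hB : ∀ p, p.Prime → Function.Periodic (B p) p)
    (h0 : ∀ p, p.Prime → 0 < residueCount B p) (h1 : ∀ p, p.Prime → residueCount B p < p) :
    (#S : ℝ) * (∑ T ∈ 𝒯, ∏ p ∈ T, sieveDensity B p) ^ 2
      ≤ X * (∑ T ∈ 𝒯, ∏ p ∈ T, sieveDensity B p) + (z : ℝ) ^ 6 := by
  classical
  -- The square of ∑ H(T) F_T(n) is summed over n < X in two ways. The mean square of F_T is 1/H(T),
  -- so with the coefficients H(T) the diagonal contributes X ∑ H(T).
  set H : Finset ℕ → ℝ := fun T => ∏ p ∈ T, sieveDensity B p with hH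
  set F : Finset ℕ → ℕ → ℝ := fun T n => ∏ p ∈ T, sieveWeight B p n with hF
  have hHpos : ∀ T ∈ 𝒯, 0 < H T := fun T hTT =>
    prod_pos fun p hp => sieveDensity_pos (h0 p (hT T hTT p hp)) (h1 p (hT T hTT p hp))
  -- A set of primes is recovered from its product, which is at most z.
  have hcard : (#𝒯 : ℝ) ≤ z := by
    have : #𝒯 ≤ #(Icc 1 z) := by
      refine card_le_card_of_injOn (fun T => ∏ p ∈ T, p) ?_ ?_
      · intro T hTT
        exact mem_Icc.2 ⟨prod_pos fun p hp => (hT T hTT p hp).pos, hz T hTT⟩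
      · intro T hTT T' hTT' h
        have := congrArg Nat.primeFactors h
        simpa only [Nat.primeFactors_prod (hT T hTT), Nat.primeFactors_prod (hT T' hTT')] using this
    rw [Nat.card_Icc] at this
    exact_mod_cast this
  have hbound : ∀ T ∈ 𝒯, ∀ n, |H T * F T n| ≤ z := by
    intro T hTT n
    simp only [hH, hF]
    rw [← prod_mul_distrib, abs_prod]
    calc ∏ p ∈ T, |sieveDensity B p * sieveWeight B p n| ≤ ∏ p ∈ T, (p : ℝ) :=
          prod_le_prod (fun _ _ => abs_nonneg _) fun p hp =>
            abs_sieveDensity_mul_sieveWeight_le (h0 p (hT T hTT p hp)) (h1 p (hT T hTT p hp)) n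
      _ = ((∏ p ∈ T, p : ℕ) : ℝ) := by push_cast; rfl
      _ ≤ z := by exact_mod_cast hz T hTT
  -- Orthogonality kills the off-diagonal terms over a full period. The period is at most z² and the
  -- summand at most z², which gives the error z⁴.
  have hpair : ∀ T ∈ 𝒯, ∀ T' ∈ 𝒯, ∑ n ∈ range X, (H T * F T n) * (H T' * F T' n) ≤
      (if T = T' then X * H T else 0) + (z : ℝ) ^ 4 := by
    intro T hTT T' hTT'
    have hUp : ∀ p ∈ T ∪ T', p.Prime := by
      intro p hp
      rcases mem_union.1 hp with h | h
      exacts [hT T hTT p h, hT T' hTT' p h]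
    have hLpos : 0 < ∏ p ∈ T ∪ T', p := prod_pos fun p hp => (hUp p hp).pos
    have hLle : ∏ p ∈ T ∪ T', p ≤ z * z := by
      calc ∏ p ∈ T ∪ T', p ≤ (∏ p ∈ T ∪ T', p) * ∏ p ∈ T ∩ T', p :=
            Nat.le_mul_of_pos_right _
              (prod_pos fun p hp => (hUp p (mem_union_left _ (mem_inter.1 hp).1)).pos)
        _ = (∏ p ∈ T, p) * ∏ p ∈ T', p := prod_union_inter
        _ ≤ z * z := Nat.mul_le_mul (hz T hTT) (hz T' hTT')
    have hper : ∀ S ⊆ T ∪ T', Function.Periodic (F S) (∏ p ∈ T ∪ T', p) := by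
      intro S hS n
      refine prod_congr rfl fun p hp => ?_
      obtain ⟨k, hk⟩ := dvd_prod_of_mem (fun p : ℕ => p) (hS hp)
      have h1 := (sieveWeight_periodic (hB p (hUp p (hS hp)))).nat_mul k
      rw [hk, mul_comm]
      exact h1 n
    have hsum : ∑ n ∈ range (∏ p ∈ T ∪ T', p), (H T * F T n) * (H T' * F T' n) =
        if T = T' then (∏ p ∈ T ∪ T', (p : ℝ)) * H T else 0 := by
      have : ∀ n, (H T * F T n) * (H T' * F T' n) = (H T * H T') * (F T n * F T' n) :=
        fun n => by ring
      rw [sum_congr rfl fun n _ => this n, ← mul_sum,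
        sum_range_prod_sieveWeight T T' (hT T hTT) (hT T' hTT') hB h0 h1]
      split_ifs with h
      · subst h
        rw [union_self]
        have := (hHpos T hTT).ne'
        simp only [hH] at this ⊢
        field_simp
      · simp
    have hLpos' : (0 : ℝ) < ∏ p ∈ T ∪ T', (p : ℝ) := by
      have : (0 : ℝ) < ((∏ p ∈ T ∪ T', p : ℕ) : ℝ) := by exact_mod_cast hLpos
      rwa [Nat.cast_prod] at this
    have := sum_range_le_of_periodic (f := fun n => (H T * F T n) * (H T' * F T' n)) hLpos
      (fun n => by
        simp only [hper T subset_union_left n, hper T' subset_union_right n])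
      (M := z * z) (fun n => by
        rw [abs_mul]
        exact mul_le_mul (hbound T hTT n) (hbound T' hTT' n) (abs_nonneg _) (by positivity))
      (by
        rw [hsum]
        split_ifs
        · exact mul_nonneg hLpos'.le (hHpos T hTT).le
        · exact le_rfl) X
    refine this.trans ?_
    rw [hsum]
    have h4 : ((∏ p ∈ T ∪ T', p : ℕ) : ℝ) * (z * z) ≤ (z : ℝ) ^ 4 := by
      calc ((∏ p ∈ T ∪ T', p : ℕ) : ℝ) * (z * z) ≤ ((z * z : ℕ) : ℝ) * (z * z) := by
            gcongr
        _ = _ := by push_cast; ring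
    refine add_le_add ?_ h4
    split_ifs
    · push_cast
      rw [← mul_assoc, div_mul_cancel₀ _ hLpos'.ne']
    · simp
  -- For sifted n every weight equals 1, so the inner sum is ∑ H(T).
  have hcs : (#S : ℝ) * (∑ T ∈ 𝒯, H T) ^ 2 ≤ ∑ n ∈ range X, (∑ T ∈ 𝒯, H T * F T n) ^ 2 := by
    calc (#S : ℝ) * (∑ T ∈ 𝒯, H T) ^ 2 = ∑ n ∈ S, (∑ T ∈ 𝒯, H T * F T n) ^ 2 := by
          rw [← nsmul_eq_mul, ← sum_const]
          refine sum_congr rfl fun n hn => ?_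
          congr 1
          refine sum_congr rfl fun T hTT => ?_
          have : F T n = 1 := prod_eq_one fun p hp => by
            unfold sieveWeight
            rw [if_neg (hST n hn T hTT p hp)]
          rw [this, mul_one]
      _ ≤ _ := sum_le_sum_of_subset_of_nonneg hS fun _ _ _ => sq_nonneg _
  refine hcs.trans ?_
  calc ∑ n ∈ range X, (∑ T ∈ 𝒯, H T * F T n) ^ 2
      = ∑ T ∈ 𝒯, ∑ T' ∈ 𝒯, ∑ n ∈ range X, (H T * F T n) * (H T' * F T' n) := by
        simp_rw [sq, sum_mul_sum]
        rw [sum_comm]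
        exact sum_congr rfl fun T _ => sum_comm
    _ ≤ ∑ T ∈ 𝒯, ∑ T' ∈ 𝒯, ((if T = T' then X * H T else 0) + (z : ℝ) ^ 4) :=
        sum_le_sum fun T hTT => sum_le_sum fun T' hTT' => hpair T hTT T' hTT'
    _ = X * (∑ T ∈ 𝒯, H T) + (#𝒯 : ℝ) * (#𝒯 * (z : ℝ) ^ 4) := by
        simp_rw [sum_add_distrib, sum_ite_eq]
        simp only [sum_const, nsmul_eq_mul]
        rw [mul_sum]
        congr 1
        exact sum_congr rfl fun T hTT => by rw [if_pos hTT]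
    _ ≤ X * (∑ T ∈ 𝒯, H T) + (z : ℝ) * (z * (z : ℝ) ^ 4) := by gcongr
    _ = _ := by ring

end Sieve

/-! ### Lower bound for the main term of the sieve. -/

/-- The completely multiplicative function with given values at the primes. -/
noncomputable def ofPrimeValues (u : ℕ → ℝ) : ℕ →* ℝ where
  toFun n := if n = 0 then 0 else n.factorization.prod fun p k => u p ^ k
  map_one' := by simp
  map_mul' m n := by
    rcases eq_or_ne m 0 with rfl | hm
    · simp
    rcases eq_or_ne n 0 with rfl | hn
    · simp
    rw [if_neg (mul_ne_zero hm hn), if_neg hm, if_neg hn, Nat.factorization_mul hm hn,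
      Finsupp.prod_add_index' (by simp) (fun _ _ _ => pow_add _ _ _)]

theorem ofPrimeValues_prime (u : ℕ → ℝ) {p : ℕ} (hp : p.Prime) : ofPrimeValues u p = u p := by
  change (if p = 0 then (0 : ℝ) else p.factorization.prod fun p k => u p ^ k) = u p
  rw [if_neg hp.ne_zero, hp.factorization, Finsupp.prod_single_index (by simp), pow_one]

theorem ofPrimeValues_nonneg {u : ℕ → ℝ} (hu : ∀ p, p.Prime → 0 ≤ u p) (n : ℕ) :
    0 ≤ ofPrimeValues u n := by
  change 0 ≤ (if n = 0 then (0 : ℝ) else n.factorization.prod fun p k => u p ^ k)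
  split_ifs
  · exact le_rfl
  · exact Finset.prod_nonneg fun p hp => pow_nonneg (hu p (Nat.prime_of_mem_primeFactors hp)) _

-- A finite part of the nonnegative series whose sum is the Euler product over T.
open Finset in
theorem sum_le_prod_of_mem_factoredNumbers {u : ℕ → ℝ} (hu : ∀ p, p.Prime → 0 ≤ u p)
    (hu1 : ∀ p, p.Prime → u p < 1) (T : Finset ℕ) (hT : ∀ p ∈ T, p.Prime) (A : Finset ℕ)
    (hA : ∀ n ∈ A, n ∈ Nat.factoredNumbers T) :
    ∑ n ∈ A, ofPrimeValues u n ≤ ∏ p ∈ T, (1 - u p)⁻¹ := by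
  have h := (EulerProduct.summable_and_hasSum_factoredNumbers_prod_filter_prime_geometric
    (f := ofPrimeValues u) (fun {p} hp => by
      rw [ofPrimeValues_prime u hp, Real.norm_of_nonneg (hu p hp)]
      exact hu1 p hp) T).2
  rw [filter_true_of_mem hT, prod_congr rfl
    (fun p hp => by rw [ofPrimeValues_prime u (hT p hp)])] at h
  replace h := (hasSum_subtype_iff_indicator (f := fun n => ofPrimeValues u n)).1 h
  calc ∑ n ∈ A, ofPrimeValues u n
      = ∑ n ∈ A, (Nat.factoredNumbers T).indicator (fun n => ofPrimeValues u n) n :=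
        sum_congr rfl fun n hn => by rw [Set.indicator_of_mem (hA n hn)]
    _ ≤ _ := sum_le_hasSum A (fun n _ => Set.indicator_nonneg
        (fun n _ => ofPrimeValues_nonneg hu n) n) h

-- Each such n is ∏ p over T times an integer supported on T, so the Euler product over T applies to
-- the cofactor. For u(p) = ρ/p the factor u/(1 - u) is the sieve density.
open Finset in
theorem sum_primeFactors_eq_le {u : ℕ → ℝ} (hu : ∀ p, p.Prime → 0 ≤ u p)
    (hu1 : ∀ p, p.Prime → u p < 1) (T : Finset ℕ) (hT : ∀ p ∈ T, p.Prime) (A : Finset ℕ) (hA0 : ∀ n ∈ A, n ≠ 0)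
    (hA : ∀ n ∈ A, n.primeFactors = T) :
    ∑ n ∈ A, ofPrimeValues u n ≤ ∏ p ∈ T, u p / (1 - u p) := by
  set P := ∏ p ∈ T, p with hP
  have hPpos : 0 < P := prod_pos fun p hp => (hT p hp).pos
  have hdvd : ∀ n ∈ A, P ∣ n := fun n hn => by
    rw [hP, ← hA n hn]
    exact Nat.prod_primeFactors_dvd n
  have hfac : ∀ n ∈ A, ofPrimeValues u n = (∏ p ∈ T, u p) * ofPrimeValues u (n / P) := by
    intro n hn
    conv_lhs => rw [← Nat.mul_div_cancel' (hdvd n hn), map_mul, hP, map_prod]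
    congr 1
    exact prod_congr rfl fun p hp => ofPrimeValues_prime u (hT p hp)
  rw [sum_congr rfl hfac, ← mul_sum, prod_div_distrib, div_eq_mul_inv, ← prod_inv_distrib]
  refine mul_le_mul_of_nonneg_left ?_ (prod_nonneg fun p hp => hu p (hT p hp))
  rw [← sum_image (f := fun n => ofPrimeValues u n) (g := fun n => n / P)]
  · refine sum_le_prod_of_mem_factoredNumbers hu hu1 T hT _ fun m hm => ?_
    obtain ⟨n, hn, rfl⟩ := mem_image.1 hm
    refine Nat.mem_factoredNumbers_of_dvd ?_ (Nat.div_dvd_of_dvd (hdvd n hn))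
    exact Nat.mem_factoredNumbers_of_primeFactors_subset (hA0 n hn) (hA n hn).le
  · intro n hn m hm h
    have h' : n / P = m / P := h
    rw [← Nat.mul_div_cancel' (hdvd n hn), ← Nat.mul_div_cancel' (hdvd m hm), h']

-- Multiplying n by p at most doubles the number of divisors coprime to D, and does not raise it
-- when p divides D.
open Finset in
theorem card_coprime_divisors_le {u : ℕ → ℝ} (D : ℕ) (hu : ∀ p, p.Prime → 1 ≤ p * u p)
    (hu2 : ∀ p, p.Prime → ¬ p ∣ D → 2 ≤ p * u p) (n : ℕ) :
    (#{b ∈ n.divisors | b.Coprime D} : ℝ) ≤ n * ofPrimeValues u n := by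
  induction n using induction_on_primes with
  | zero => simp
  | one =>
    have : #{b ∈ ({1} : Finset ℕ) | b.Coprime D} ≤ 1 := card_filter_le _ _
    simpa using this
  | prime_mul p a hp ih =>
    rcases eq_or_ne a 0 with rfl | ha
    · simp
    have hsub : {b ∈ (p * a).divisors | b.Coprime D} ⊆ {b ∈ a.divisors | b.Coprime D} ∪
        (if p ∣ D then ∅ else {b ∈ a.divisors | b.Coprime D}.image (p * ·)) := by
      intro b hb
      rw [mem_filter, Nat.mem_divisors] at hb
      by_cases hpb : p ∣ b
      · obtain ⟨c, rfl⟩ := hpb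
        have hpD : ¬ p ∣ D := fun h =>
          hp.one_lt.ne' (Nat.dvd_one.1 (hb.2 ▸ Nat.dvd_gcd (Dvd.intro _ rfl) h))
        rw [if_neg hpD]
        refine mem_union_right _ (mem_image.2 ⟨c, ?_, rfl⟩)
        rw [mem_filter, Nat.mem_divisors]
        exact ⟨⟨Nat.dvd_of_mul_dvd_mul_left hp.pos hb.1.1, ha⟩, Nat.Coprime.coprime_mul_left hb.2⟩
      · refine mem_union_left _ ?_
        rw [mem_filter, Nat.mem_divisors]
        exact ⟨⟨(Nat.Coprime.dvd_mul_left ((Nat.Prime.coprime_iff_not_dvd hp).2 hpb).symm).1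
          hb.1.1, ha⟩, hb.2⟩
    have hcard := (card_le_card hsub).trans (card_union_le _ _)
    have hnn : (0 : ℝ) ≤ #{b ∈ a.divisors | b.Coprime D} := by positivity
    rw [map_mul, ofPrimeValues_prime u hp]
    push_cast
    have hre : (p : ℝ) * a * (u p * ofPrimeValues u a) = (p * u p) * (a * ofPrimeValues u a) := by
      ring
    rw [hre]
    by_cases hpD : p ∣ D
    · rw [if_pos hpD, card_empty, add_zero] at hcard
      have : (#{b ∈ (p * a).divisors | b.Coprime D} : ℝ) ≤ #{b ∈ a.divisors | b.Coprime D} := by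
        exact_mod_cast hcard
      nlinarith [hu p hp]
    · rw [if_neg hpD] at hcard
      have : (#{b ∈ (p * a).divisors | b.Coprime D} : ℝ) ≤ #{b ∈ a.divisors | b.Coprime D}
          + #{b ∈ a.divisors | b.Coprime D} := by
        exact_mod_cast hcard.trans (Nat.add_le_add_left card_image_le _)
      nlinarith [hu2 p hp hpD]

-- The multiples of q among the surviving integers are q times surviving integers, so removing them
-- costs at most the fraction 1/q of the sum.
open Finset in
theorem sum_inv_mul_prod_le (y : ℕ) (T : Finset ℕ) (hT : ∀ p ∈ T, p.Prime) :
    (∑ n ∈ Icc 1 y, (n : ℝ)⁻¹) * ∏ p ∈ T, (1 - (p : ℝ)⁻¹) ≤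
      ∑ n ∈ Icc 1 y with ∀ p ∈ T, ¬ p ∣ n, (n : ℝ)⁻¹ := by
  induction T using Finset.induction_on with
  | empty => simp
  | insert q T hq ih =>
    have hqp := hT q (mem_insert_self _ _)
    have ih := ih fun p hp => hT p (mem_insert_of_mem hp)
    have hq0 : (q : ℝ) ≠ 0 := by exact_mod_cast hqp.ne_zero
    have hq1 : (q : ℝ)⁻¹ ≤ 1 := inv_le_one_of_one_le₀ (by exact_mod_cast hqp.one_lt.le)
    rw [prod_insert hq]
    set A := {n ∈ Icc 1 y | ∀ p ∈ T, ¬ p ∣ n} with hA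
    have hsplit := sum_filter_add_sum_filter_not A (fun n => q ∣ n) (fun n : ℕ => (n : ℝ)⁻¹)
    have hdiv : ∑ n ∈ A with q ∣ n, (n : ℝ)⁻¹ ≤ (q : ℝ)⁻¹ * ∑ n ∈ A, (n : ℝ)⁻¹ := by
      rw [mul_sum]
      have hsub : {n ∈ A | q ∣ n} ⊆ A.image (q * ·) := by
        intro n hn
        simp only [hA, mem_filter, mem_Icc] at hn
        obtain ⟨m, rfl⟩ := hn.2
        refine mem_image.2 ⟨m, ?_, rfl⟩
        simp only [hA, mem_filter, mem_Icc]
        refine ⟨⟨Nat.pos_of_mul_pos_left (Nat.lt_of_lt_of_le Nat.zero_lt_one hn.1.1.1), ?_⟩, ?_⟩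
        · exact (Nat.le_mul_of_pos_left _ hqp.pos).trans hn.1.1.2
        · exact fun p hp h => hn.1.2 p hp (Dvd.dvd.mul_left h q)
      refine (sum_le_sum_of_subset_of_nonneg hsub fun _ _ _ => by positivity).trans ?_
      rw [sum_image fun a _ b _ h => Nat.eq_of_mul_eq_mul_left hqp.pos h]
      exact le_of_eq (sum_congr rfl fun n _ => by push_cast; rw [mul_inv])
    have heq : {n ∈ Icc 1 y | ∀ p ∈ insert q T, ¬ p ∣ n} = {n ∈ A | ¬ q ∣ n} := by
      ext n
      simp only [hA, mem_filter, mem_insert, forall_eq_or_imp]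
      tauto
    rw [heq]
    have hle : (1 - (q : ℝ)⁻¹) * ((∑ n ∈ Icc 1 y, (n : ℝ)⁻¹) * ∏ p ∈ T, (1 - (p : ℝ)⁻¹)) ≤
        (1 - (q : ℝ)⁻¹) * ∑ n ∈ A, (n : ℝ)⁻¹ := mul_le_mul_of_nonneg_left ih (by linarith)
    linarith

open Finset in
/-- Lower bound for the main term of Selberg's sieve for a sieve of dimension two. -/
theorem sum_prod_sieveDensity_ge {B : ℕ → ℕ → Prop} (D y : ℕ) (hD : D ≠ 0)
    (h0 : ∀ p, p.Prime → 0 < residueCount B p) (h1 : ∀ p, p.Prime → residueCount B p < p)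
    (h2 : ∀ p, p.Prime → ¬ p ∣ D → 2 ≤ residueCount B p) :
    (∑ n ∈ Icc 1 y, (n : ℝ)⁻¹) * ((∑ n ∈ Icc 1 y, (n : ℝ)⁻¹) * ∏ p ∈ D.primeFactors,
      (1 - (p : ℝ)⁻¹)) ≤
    ∑ T ∈ (Icc 1 (y * y)).image Nat.primeFactors, ∏ p ∈ T, sieveDensity B p := by
  set u : ℕ → ℝ := fun p => residueCount B p / p with hu
  have hmul : ∀ p : ℕ, p.Prime → (p : ℝ) * u p = residueCount B p := fun p hp => by
    have : (p : ℝ) ≠ 0 := by exact_mod_cast hp.ne_zero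
    simp only [hu]
    field_simp
  have hu0 : ∀ p, p.Prime → 0 ≤ u p := fun p _ => by positivity
  have hu1 : ∀ p, p.Prime → u p < 1 := fun p hp => by
    have : (0 : ℝ) < p := by exact_mod_cast hp.pos
    rw [hu, div_lt_one this]
    exact_mod_cast h1 p hp
  have hdens : ∀ p, p.Prime → u p / (1 - u p) = sieveDensity B p := fun p hp => by
    have : (0 : ℝ) < p := by exact_mod_cast hp.pos
    have h3 : (residueCount B p : ℝ) < p := by exact_mod_cast h1 p hp
    have h4 : (p : ℝ) - residueCount B p ≠ 0 := by linarith
    simp only [hu, sieveDensity]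
    rw [one_sub_div this.ne']
    field_simp
  -- The integers n ≤ y² are grouped by their sets of prime factors.
  have hstep1 : ∑ n ∈ Icc 1 (y * y), ofPrimeValues u n ≤
      ∑ T ∈ (Icc 1 (y * y)).image Nat.primeFactors, ∏ p ∈ T, sieveDensity B p := by
    rw [← sum_fiberwise_of_maps_to (g := Nat.primeFactors)
      (fun n hn => mem_image_of_mem _ hn) (fun n => ofPrimeValues u n)]
    refine sum_le_sum fun T hT => ?_
    obtain ⟨m, _, rfl⟩ := mem_image.1 hT
    rw [← prod_congr rfl fun p hp => hdens p (Nat.prime_of_mem_primeFactors hp)]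
    refine sum_primeFactors_eq_le hu0 hu1 _ (fun p hp => Nat.prime_of_mem_primeFactors hp) _ ?_ ?_
    · intro n hn
      have := (mem_Icc.1 (mem_filter.1 hn).1).1
      omega
    · exact fun n hn => (mem_filter.1 hn).2
  refine le_trans ?_ hstep1
  have hstep2 : ∀ n ∈ Icc 1 (y * y), (#{b ∈ n.divisors | b.Coprime D} : ℝ) * (n : ℝ)⁻¹ ≤
      ofPrimeValues u n := by
    intro n hn
    have hn0 : (0 : ℝ) < n := by exact_mod_cast (mem_Icc.1 hn).1
    rw [← div_eq_mul_inv, div_le_iff₀ hn0, mul_comm]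
    refine card_coprime_divisors_le D ?_ ?_ n
    · intro p hp
      rw [hmul p hp]
      exact_mod_cast h0 p hp
    · intro p hp hpD
      rw [hmul p hp]
      exact_mod_cast h2 p hp hpD
  refine le_trans ?_ (sum_le_sum hstep2)
  set C := {n ∈ Icc 1 y | ∀ p ∈ D.primeFactors, ¬ p ∣ n} with hC
  -- The product is expanded over pairs (a, b) and sorted by n = ab; given n, the pair is determined
  -- by b, a divisor of n coprime to D.
  have hstep3 : (∑ n ∈ Icc 1 y, (n : ℝ)⁻¹) * ∑ b ∈ C, (b : ℝ)⁻¹ ≤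
      ∑ n ∈ Icc 1 (y * y), (#{b ∈ n.divisors | b.Coprime D} : ℝ) * (n : ℝ)⁻¹ := by
    have hmaps : ∀ x ∈ Icc 1 y ×ˢ C, x.1 * x.2 ∈ Icc 1 (y * y) := by
      intro x hx
      simp only [hC, mem_product, mem_Icc, mem_filter] at hx
      exact mem_Icc.2 ⟨Nat.mul_pos hx.1.1 hx.2.1.1, Nat.mul_le_mul hx.1.2 hx.2.1.2⟩
    rw [sum_mul_sum, ← sum_product' (f := fun a b : ℕ => (a : ℝ)⁻¹ * (b : ℝ)⁻¹),
      ← sum_fiberwise_of_maps_to hmaps]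
    refine sum_le_sum fun n hn => ?_
    have hn1 := (mem_Icc.1 hn).1
    rw [sum_congr rfl (g := fun _ => (n : ℝ)⁻¹), sum_const, nsmul_eq_mul]
    · refine mul_le_mul_of_nonneg_right ?_ (by positivity)
      norm_cast
      refine card_le_card_of_injOn Prod.snd ?_ ?_
      · intro x hx
        simp only [hC, mem_product, mem_Icc, mem_filter, coe_filter, Set.mem_ofPred_eq] at hx
        simp only [coe_filter, Set.mem_ofPred_eq, Nat.mem_divisors]
        refine ⟨⟨hx.2 ▸ Dvd.intro_left _ rfl, by omega⟩, ?_⟩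
        refine Nat.Coprime.symm (Nat.coprime_of_dvd fun p hp hpD hpb => ?_)
        exact hx.1.2.2 p (Nat.mem_primeFactors.2 ⟨hp, hpD, hD⟩) hpb
      · intro x hx x' hx' h
        simp only [coe_filter, Set.mem_ofPred_eq, mem_product, hC, mem_filter, mem_Icc] at hx hx'
        refine Prod.ext ?_ h
        have h' := hx.2.trans hx'.2.symm
        rw [h] at h'
        exact Nat.eq_of_mul_eq_mul_right hx'.1.2.1.1 h'
    · intro x hx
      rw [← (mem_filter.1 hx).2]
      push_cast
      rw [mul_inv]
  refine le_trans ?_ hstep3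
  refine mul_le_mul_of_nonneg_left ?_ (sum_nonneg fun _ _ => by positivity)
  exact sum_inv_mul_prod_le y _ fun p hp => Nat.prime_of_mem_primeFactors hp

/-! ### Prime pairs with a given difference. -/

/-- The residues to be avoided modulo `p` by `n` when `n` and `n + d` are large primes. -/
def pairResidue (d p n : ℕ) : Prop := if p ∣ 2 * d then p ∣ n else p ∣ n ∨ p ∣ n + d

theorem pairResidue_periodic (d p : ℕ) : Function.Periodic (pairResidue d p) p := by
  intro n
  unfold pairResidue
  have : n + p + d = n + d + p := by ring
  rw [this, Nat.dvd_add_self_right, Nat.dvd_add_self_right]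

theorem residueCount_pairResidue_of_dvd {d p : ℕ} (hp : p.Prime) (h : p ∣ 2 * d) :
    residueCount (pairResidue d) p = 1 := by
  classical
  unfold residueCount
  have : Finset.filter (pairResidue d p) (Finset.range p) = {0} := by
    ext n
    simp only [Finset.mem_filter, Finset.mem_range, pairResidue, h, if_true, Finset.mem_singleton]
    constructor
    · rintro ⟨h1, h2⟩
      exact Nat.eq_zero_of_dvd_of_lt h2 h1
    · rintro rfl
      exact ⟨hp.pos, dvd_zero _⟩
  convert Finset.card_singleton 0

theorem residueCount_pairResidue_of_not_dvd {d p : ℕ} (h : ¬ p ∣ 2 * d) (hp : p.Prime) :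
    residueCount (pairResidue d) p = 2 := by
  classical
  unfold residueCount
  have hd : d % p ≠ 0 := fun h' => h (Dvd.dvd.mul_left (Nat.dvd_of_mod_eq_zero h') 2)
  have hlt := Nat.mod_lt d hp.pos
  have : Finset.filter (pairResidue d p) (Finset.range p) = {0, p - d % p} := by
    ext n
    simp only [Finset.mem_filter, Finset.mem_range, pairResidue, h, if_false, Finset.mem_insert,
      Finset.mem_singleton]
    have hiff : p ∣ n + d ↔ p ∣ n + d % p := by
      rw [Nat.dvd_iff_mod_eq_zero, Nat.dvd_iff_mod_eq_zero, Nat.add_mod_mod]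
    constructor
    · rintro ⟨h1, h2 | h2⟩
      · exact Or.inl (Nat.eq_zero_of_dvd_of_lt h2 h1)
      · right
        obtain ⟨k, hk⟩ := hiff.1 h2
        have : k = 1 := by
          have h3 : 0 < k := by
            rcases Nat.eq_zero_or_pos k with rfl | h3
            · omega
            · exact h3
          have h4 : k < 2 := by
            by_contra h4
            have : p * 2 ≤ p * k := Nat.mul_le_mul_left p (by omega)
            omega
          omega
        subst this
        omega
    · rintro (rfl | rfl)
      · exact ⟨hp.pos, Or.inl (dvd_zero _)⟩
      · refine ⟨by omega, Or.inr (hiff.2 ?_)⟩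
        rw [Nat.sub_add_cancel hlt.le]
  have h2 : Finset.card ({0, p - d % p} : Finset ℕ) = 2 := Finset.card_pair (by omega)
  rw [← h2, ← this]

open Finset in
set_option maxHeartbeats 800000 in
/-- The sieve bound for the number of prime pairs with a given difference. -/
theorem card_prime_pairs_le (d Y : ℕ) (hd : d ≠ 0) (hY : 2 ≤ Y) :
    (#{n ∈ range (Y ^ 16) | n.Prime ∧ (n + d).Prime} : ℝ) ≤
      (Y : ℝ) ^ 16 * ((2 * d : ℕ) / (2 * d).totient) / Real.log Y ^ 2 + 2 * (Y : ℝ) ^ 12 := by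
  classical
  -- The factor 2 forces a single bad class at p = 2. For odd d the two conditions would exclude
  -- every residue modulo 2.
  set D := 2 * d with hDdef
  have hD : D ≠ 0 := by omega
  have h0 : ∀ p, p.Prime → 0 < residueCount (pairResidue d) p := by
    intro p hp
    by_cases h : p ∣ D
    · rw [residueCount_pairResidue_of_dvd hp h]; norm_num
    · rw [residueCount_pairResidue_of_not_dvd h hp]; norm_num
  have h1 : ∀ p, p.Prime → residueCount (pairResidue d) p < p := by
    intro p hp
    by_cases h : p ∣ D
    · rw [residueCount_pairResidue_of_dvd hp h]; exact hp.one_lt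
    · rw [residueCount_pairResidue_of_not_dvd h hp]
      have : p ≠ 2 := by
        rintro rfl
        exact h (Dvd.intro _ rfl)
      have := hp.two_le
      omega
  have h2 : ∀ p, p.Prime → ¬ p ∣ D → 2 ≤ residueCount (pairResidue d) p := by
    intro p hp h
    rw [residueCount_pairResidue_of_not_dvd h hp]
  set 𝒯 := (Icc 1 (Y * Y)).image Nat.primeFactors with h𝒯
  have hTp : ∀ T ∈ 𝒯, ∀ p ∈ T, p.Prime := by
    intro T hT p hp
    obtain ⟨m, _, rfl⟩ := mem_image.1 hT
    exact Nat.prime_of_mem_primeFactors hp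
  have hTz : ∀ T ∈ 𝒯, ∏ p ∈ T, p ≤ Y * Y := by
    intro T hT
    obtain ⟨m, hm, rfl⟩ := mem_image.1 hT
    rw [mem_Icc] at hm
    exact (Nat.le_of_dvd hm.1 (Nat.prod_primeFactors_dvd m)).trans hm.2
  have hTle : ∀ T ∈ 𝒯, ∀ p ∈ T, p ≤ Y * Y := by
    intro T hT p hp
    obtain ⟨m, hm, rfl⟩ := mem_image.1 hT
    rw [mem_Icc] at hm
    exact (Nat.le_of_dvd hm.1 (Nat.dvd_of_mem_primeFactors hp)).trans hm.2
  -- Sieving primes reach Y², and a prime n up to Y² would be sifted out by itself; those n are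
  -- added back trivially.
  set S := {n ∈ range (Y ^ 16) | (n.Prime ∧ (n + d).Prime) ∧ Y * Y < n} with hS
  have hsieve := card_mul_sq_le_of_sieve (B := pairResidue d) 𝒯 (Y * Y) (Y ^ 16) S
    (filter_subset _ _) hTp hTz (by
      intro n hn T hT p hp hB
      rw [hS, mem_filter] at hn
      have hpp := hTp T hT p hp
      have hle := hTle T hT p hp
      have hA : ¬ p ∣ n := fun h => by
        have := (Nat.prime_dvd_prime_iff_eq hpp hn.2.1.1).1 h
        omega
      have hA' : ¬ p ∣ n + d := fun h => by
        have := (Nat.prime_dvd_prime_iff_eq hpp hn.2.1.2).1 h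
        omega
      unfold pairResidue at hB
      split_ifs at hB <;> tauto) (fun p _ => pairResidue_periodic d p) h0 h1
  set V := ∑ T ∈ 𝒯, ∏ p ∈ T, sieveDensity (pairResidue d) p with hV
  clear_value V
  have hlog : 0 < Real.log Y := Real.log_pos (by exact_mod_cast hY)
  have hharm : Real.log Y ≤ ∑ n ∈ Icc 1 Y, (n : ℝ)⁻¹ := by
    have := log_add_one_le_harmonic Y
    rw [harmonic_eq_sum_Icc] at this
    push_cast at this
    refine le_trans (Real.log_le_log (by exact_mod_cast (by omega : 0 < Y)) ?_) this
    linarith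
  have hφ : ∏ p ∈ D.primeFactors, (1 - (p : ℝ)⁻¹) = D.totient / D := by
    have := congrArg (fun q : ℚ => (q : ℝ)) (Nat.totient_eq_mul_prod_factors D)
    push_cast at this
    rw [this, mul_div_cancel_left₀]
    exact_mod_cast hD
  have hφpos : (0 : ℝ) < D.totient / D := by
    have : 0 < D.totient := Nat.totient_pos.2 (by omega)
    positivity
  have hVge : Real.log Y ^ 2 * (D.totient / D) ≤ V := by
    have := sum_prod_sieveDensity_ge D Y hD h0 h1 h2
    rw [hφ] at this
    rw [hV]
    refine le_trans ?_ this
    rw [sq, mul_assoc]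
    gcongr
  -- The empty set contributes 1; this absorbs the error Y¹² into Y¹² V² before dividing by V².
  have hV1 : 1 ≤ V := by
    rw [hV]
    have hmem : ∅ ∈ 𝒯 := mem_image.2 ⟨1, mem_Icc.2 ⟨le_rfl, by nlinarith⟩, by simp⟩
    have := single_le_sum (f := fun T => ∏ p ∈ T, sieveDensity (pairResidue d) p)
      (fun T hT => prod_nonneg fun p hp => (sieveDensity_pos (h0 p (hTp T hT p hp))
        (h1 p (hTp T hT p hp))).le) hmem
    simpa using this
  have hSle : (#S : ℝ) ≤ (Y : ℝ) ^ 16 / V + (Y : ℝ) ^ 12 := by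
    have hVpos : 0 < V := by linarith
    have h3 : (#S : ℝ) * V ^ 2 ≤ (Y : ℝ) ^ 16 * V + (Y : ℝ) ^ 12 * V ^ 2 := by
      refine hsieve.trans ?_
      push_cast
      have : ((Y : ℝ) * Y) ^ 6 = (Y : ℝ) ^ 12 * 1 := by ring
      rw [this]
      have : (1 : ℝ) ≤ V ^ 2 := one_le_pow₀ hV1
      gcongr
    have h4 : ((Y : ℝ) ^ 16 / V + (Y : ℝ) ^ 12) * V ^ 2 = (Y : ℝ) ^ 16 * V + (Y : ℝ) ^ 12 * V ^ 2 := by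
      field_simp
    rw [← h4] at h3
    exact le_of_mul_le_mul_right h3 (pow_pos hVpos 2)
  have hsub : {n ∈ range (Y ^ 16) | n.Prime ∧ (n + d).Prime} ⊆ S ∪ Icc 1 (Y * Y) := by
    intro n hn
    rw [mem_filter] at hn
    rw [mem_union, hS, mem_filter, mem_Icc]
    by_cases h : Y * Y < n
    · exact Or.inl ⟨hn.1, hn.2, h⟩
    · exact Or.inr ⟨hn.2.1.pos, by omega⟩
  have hcard : (#{n ∈ range (Y ^ 16) | n.Prime ∧ (n + d).Prime} : ℝ) ≤ #S + (Y : ℝ) ^ 2 := by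
    have := (card_le_card hsub).trans (card_union_le _ _)
    rw [Nat.card_Icc, Nat.add_sub_cancel] at this
    rw [sq]
    exact_mod_cast this
  have hY1 : (1 : ℝ) ≤ Y := by exact_mod_cast (by omega : 1 ≤ Y)
  have hpow : (Y : ℝ) ^ 2 ≤ (Y : ℝ) ^ 12 := pow_le_pow_right₀ hY1 (by norm_num)
  have hdiv : (Y : ℝ) ^ 16 / V ≤ (Y : ℝ) ^ 16 * (D / D.totient) / Real.log Y ^ 2 := by
    calc (Y : ℝ) ^ 16 / V ≤ (Y : ℝ) ^ 16 / (Real.log Y ^ 2 * (D.totient / D)) := by gcongr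
      _ = _ := by rw [mul_comm, ← div_div, ← inv_div (D.totient : ℝ), div_eq_mul_inv ((Y : ℝ) ^ 16)]
  linarith

/-! ### The second moment of d/φ(d). -/

-- The square is at most ∏ (1 + 8/p) over p ∣ d. Expanding over sets T of primes dividing d and
-- summing over d first gives X ∏ (1 + 8/p²), and this product is bounded.
open Finset in
theorem sum_Icc_sq_div_totient_le (X : ℕ) :
    ∑ d ∈ Icc 1 X, ((d : ℝ) / d.totient) ^ 2 ≤ Real.exp (8 * ∑' n : ℕ, 1 / (n : ℝ) ^ 2) * X := by
  classical
  have hloc : ∀ p : ℕ, p.Prime → ((1 - (p : ℝ)⁻¹)⁻¹) ^ 2 ≤ 1 + 8 / (p : ℝ) := by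
    intro p hp
    have h2 : (2 : ℝ) ≤ p := by exact_mod_cast hp.two_le
    have h3 : (1 - (p : ℝ)⁻¹)⁻¹ = p / (p - 1) := by
      have : (p : ℝ) - 1 ≠ 0 := by linarith
      have : (p : ℝ) ≠ 0 := by linarith
      rw [← one_div (p : ℝ), one_sub_div this, inv_div]
    rw [h3, div_pow, one_add_div (by linarith), div_le_div_iff₀ (by nlinarith) (by linarith)]
    nlinarith [mul_nonneg (by linarith : (0 : ℝ) ≤ p - 2) (by linarith : (0 : ℝ) ≤ p - 2)]
  have hterm : ∀ d ∈ Icc 1 X, ((d : ℝ) / d.totient) ^ 2 ≤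
      ∑ T ∈ (filter Nat.Prime (Icc 1 X)).powerset,
        if T ⊆ d.primeFactors then ∏ p ∈ T, 8 / (p : ℝ) else 0 := by
    intro d hd
    rw [mem_Icc] at hd
    have hd0 : (d : ℝ) ≠ 0 := by exact_mod_cast (by omega : d ≠ 0)
    have hφ : (d : ℝ) / d.totient = ∏ p ∈ d.primeFactors, (1 - (p : ℝ)⁻¹)⁻¹ := by
      have := congrArg (fun q : ℚ => (q : ℝ)) (Nat.totient_eq_mul_prod_factors d)
      push_cast at this
      rw [this, prod_inv_distrib, ← div_div, div_self hd0, one_div]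
    rw [hφ, ← prod_pow]
    have hsub : d.primeFactors ⊆ filter Nat.Prime (Icc 1 X) := by
      intro p hp
      have h := Nat.mem_primeFactors.1 hp
      exact mem_filter.2 ⟨mem_Icc.2 ⟨h.1.pos, (Nat.le_of_dvd (by omega) h.2.1).trans hd.2⟩, h.1⟩
    calc ∏ p ∈ d.primeFactors, ((1 - (p : ℝ)⁻¹)⁻¹) ^ 2
        ≤ ∏ p ∈ d.primeFactors, (1 + 8 / (p : ℝ)) := prod_le_prod (fun _ _ => sq_nonneg _)
          fun p hp => hloc p (Nat.prime_of_mem_primeFactors hp)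
      _ = ∑ T ∈ d.primeFactors.powerset, ∏ p ∈ T, 8 / (p : ℝ) := prod_one_add _
      _ = ∑ T ∈ d.primeFactors.powerset,
          if T ⊆ d.primeFactors then ∏ p ∈ T, 8 / (p : ℝ) else 0 :=
          sum_congr rfl fun T hT => by rw [if_pos (mem_powerset.1 hT)]
      _ ≤ _ := sum_le_sum_of_subset_of_nonneg (powerset_mono.2 hsub) fun T _ _ => by
          split_ifs
          · positivity
          · exact le_rfl
  refine (sum_le_sum hterm).trans ?_
  rw [sum_comm]
  calc ∑ T ∈ (filter Nat.Prime (Icc 1 X)).powerset, ∑ d ∈ Icc 1 X,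
        (if T ⊆ d.primeFactors then ∏ p ∈ T, 8 / (p : ℝ) else 0)
      ≤ ∑ T ∈ (filter Nat.Prime (Icc 1 X)).powerset, (X : ℝ) * ∏ p ∈ T, 8 / (p : ℝ) ^ 2 := by
        refine sum_le_sum fun T hT => ?_
        have hTp : ∀ p ∈ T, p.Prime := fun p hp => (mem_filter.1 (mem_powerset.1 hT hp)).2
        rw [← sum_filter, sum_const, nsmul_eq_mul]
        have hcard : #{d ∈ Icc 1 X | T ⊆ d.primeFactors} ≤ X / ∏ p ∈ T, p := by
          rw [← Nat.Ioc_filter_dvd_card_eq_div]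
          refine card_le_card fun d hd => ?_
          rw [mem_filter, mem_Icc] at hd
          refine mem_filter.2 ⟨mem_Ioc.2 ⟨hd.1.1, hd.1.2⟩, ?_⟩
          exact (prod_dvd_prod_of_subset _ _ _ hd.2).trans (Nat.prod_primeFactors_dvd d)
        have hcard' : (#{d ∈ Icc 1 X | T ⊆ d.primeFactors} : ℝ) ≤ X / ∏ p ∈ T, (p : ℝ) := by
          rw [← Nat.cast_prod]
          exact (Nat.cast_le.2 hcard).trans Nat.cast_div_le
        calc (#{d ∈ Icc 1 X | T ⊆ d.primeFactors} : ℝ) * ∏ p ∈ T, 8 / (p : ℝ)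
            ≤ X / (∏ p ∈ T, (p : ℝ)) * ∏ p ∈ T, 8 / (p : ℝ) := by gcongr
          _ = X * ∏ p ∈ T, 8 / (p : ℝ) ^ 2 := by
            rw [div_mul_eq_mul_div, mul_div_assoc, ← prod_div_distrib]
            congr 1
            exact prod_congr rfl fun p _ => by rw [div_div, sq]
    _ = X * ∏ p ∈ filter Nat.Prime (Icc 1 X), (1 + 8 / (p : ℝ) ^ 2) := by
        rw [← mul_sum, prod_one_add]
    _ ≤ X * Real.exp (∑ p ∈ filter Nat.Prime (Icc 1 X), 8 / (p : ℝ) ^ 2) := by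
        gcongr
        rw [Real.exp_sum]
        refine prod_le_prod (fun _ _ => by positivity) fun p _ => ?_
        rw [add_comm]
        exact Real.add_one_le_exp _
    _ ≤ X * Real.exp (8 * ∑' n : ℕ, 1 / (n : ℝ) ^ 2) := by
        gcongr
        calc ∑ p ∈ filter Nat.Prime (Icc 1 X), 8 / (p : ℝ) ^ 2
            = 8 * ∑ p ∈ filter Nat.Prime (Icc 1 X), 1 / (p : ℝ) ^ 2 := by
              rw [mul_sum]
              exact sum_congr rfl fun p _ => by rw [mul_one_div]
          _ ≤ _ := by
              refine mul_le_mul_of_nonneg_left ?_ (by norm_num)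
              exact (Real.summable_one_div_nat_pow.2 (by norm_num)).sum_le_tsum _
                fun _ _ => by positivity
    _ = _ := mul_comm _ _

/-! ### Chebyshev bounds and the size of the n-th prime. -/

theorem mul_div_log_le_primeCounting {n : ℕ} (hn : 2 ≤ n) :
    Real.log (4 / 3) / 2 * n / Real.log n ≤ Nat.primeCounting n := by
  -- This bounds log(n + 1) by n (log 3)/2, and log 2 - (log 3)/2 = log(4/3)/2 is the constant that
  -- remains.
  have hpow : (n + 1) ^ 2 ≤ 3 ^ n := by
    induction n, hn using Nat.le_induction with
    | base => norm_num
    | succ n hn ih =>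
      rw [pow_succ 3]
      nlinarith
  have hlog : 2 * Real.log (n + 1) ≤ n * Real.log 3 := by
    have h := Real.log_le_log (by positivity) (by exact_mod_cast hpow : ((n : ℝ) + 1) ^ 2 ≤ 3 ^ n)
    rwa [Real.log_pow, Real.log_pow] at h
  refine le_trans ?_ (Chebyshev.pi_ge n)
  have hlogn : 0 < Real.log n := Real.log_pos (by exact_mod_cast hn)
  have h4 : Real.log (4 / 3) = 2 * Real.log 2 - Real.log 3 := by
    rw [Real.log_div (by norm_num) (by norm_num), show (4 : ℝ) = 2 ^ 2 by norm_num, Real.log_pow]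
    norm_num
  gcongr
  rw [h4]
  linarith

theorem primeCounting_mul_log_le {n : ℕ} (hn : 2 ≤ n) :
    Nat.primeCounting n * Real.log n ≤ 5 * n := by
  have hn1 : (1 : ℝ) < n := by exact_mod_cast hn
  have h := Chebyshev.pi_le_log4_mul_div hn1
  rw [Nat.floor_natCast] at h
  have hlogn : 0 < Real.log n := Real.log_pos hn1
  have hsqrt : Real.log (√(n : ℝ)) = Real.log n / 2 := Real.log_sqrt (by positivity)
  have h1 : Real.log (√(n : ℝ)) ≤ √(n : ℝ) := Real.log_le_self (Real.sqrt_nonneg _)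
  have h2 : √(n : ℝ) * √(n : ℝ) = n := Real.mul_self_sqrt (by positivity)
  have h4 : Real.log 4 ≤ 3 / 2 := by
    rw [show (4 : ℝ) = 2 ^ 2 by norm_num, Real.log_pow]
    have := Real.log_two_lt_d9
    push_cast
    linarith
  have h3 : √(n : ℝ) * Real.log n ≤ 2 * n := by
    rw [hsqrt] at h1
    -- The constant 5 is 3 + 2: here √n log n ≤ 2n, and 2 log 4 ≤ 3.
    nlinarith [Real.sqrt_nonneg (n : ℝ)]
  calc Nat.primeCounting n * Real.log n
      ≤ (Real.log 4 * n / Real.log √(n : ℝ) + √(n : ℝ)) * Real.log n := by gcongr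
    _ = 2 * Real.log 4 * n + √(n : ℝ) * Real.log n := by
      rw [hsqrt]
      field_simp
    _ ≤ 5 * n := by nlinarith

theorem primeSeq_prime (n : ℕ) : (primeSeq n).Prime := Nat.prime_nth_prime _

theorem primeCounting_primeSeq {n : ℕ} (hn : 1 ≤ n) : Nat.primeCounting (primeSeq n) = n := by
  unfold primeSeq Nat.primeCounting Nat.primeCounting'
  rw [Nat.count_nth_succ_of_infinite Nat.infinite_setOfPred_prime]
  omega

theorem primeSeq_primeCounting {p : ℕ} (hp : p.Prime) : primeSeq (Nat.primeCounting p) = p := by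
  unfold primeSeq Nat.primeCounting Nat.primeCounting'
  rw [Nat.count_succ, if_pos hp, Nat.add_sub_cancel, Nat.nth_count hp]

theorem mul_logOne_le_primeSeq {n : ℕ} (hn : 1 ≤ n) : n * logOne n ≤ 5 * primeSeq n := by
  have hp := primeSeq_prime n
  have h := primeCounting_mul_log_le hp.two_le
  rw [primeCounting_primeSeq hn] at h
  have hle : n ≤ primeSeq n := by
    have := Nat.add_two_le_nth_prime (n - 1)
    unfold primeSeq
    omega
  have hle' : (n : ℝ) ≤ primeSeq n := by exact_mod_cast hle
  have hn0 : (0 : ℝ) < n := by exact_mod_cast hn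
  unfold logOne
  rcases max_choice 1 (Real.log n) with h1 | h1 <;> rw [h1]
  · linarith
  · refine le_trans ?_ h
    gcongr

theorem primeSeq_le_mul_logOne : ∃ C : ℝ, 0 < C ∧ ∀ n : ℕ, 1 ≤ n →
    (primeSeq n : ℝ) ≤ C * (n * logOne n) := by
  set c := Real.log (4 / 3) / 2 with hc
  have hcpos : 0 < c := div_pos (Real.log_pos (by norm_num)) (by norm_num)
  refine ⟨(|Real.log (4 / c ^ 2)| + 2) / c, by positivity, fun n hn => ?_⟩
  have hp := primeSeq_prime n
  set p := primeSeq n with hpdef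
  have h := mul_div_log_le_primeCounting hp.two_le
  rw [hpdef, primeCounting_primeSeq hn, ← hpdef] at h
  have hp1 : (1 : ℝ) < p := by exact_mod_cast hp.one_lt
  have hlogp : 0 < Real.log p := Real.log_pos hp1
  rw [div_le_iff₀ hlogp] at h
  have hn0 : (0 : ℝ) < n := by exact_mod_cast hn
  have hsq : √(p : ℝ) * √(p : ℝ) = p := Real.mul_self_sqrt (by positivity)
  have hsqpos : 0 < √(p : ℝ) := Real.sqrt_pos.2 (by linarith)
  have hlogsq : Real.log p ≤ 2 * √(p : ℝ) := by
    have h1 : Real.log (√(p : ℝ)) ≤ √(p : ℝ) := Real.log_le_self (Real.sqrt_nonneg _)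
    rw [Real.log_sqrt (by positivity)] at h1
    linarith
  -- The crude bound log p ≤ 2√p turns c p ≤ n log p into p ≪ n², so log p ≪ log n, which is fed
  -- back into c p ≤ n log p.
  have h1 : c * √(p : ℝ) ≤ 2 * n := by
    have : c * √(p : ℝ) * √(p : ℝ) ≤ 2 * n * √(p : ℝ) := by
      rw [mul_assoc, hsq]
      nlinarith
    exact le_of_mul_le_mul_right this hsqpos
  have h2 : (p : ℝ) ≤ 4 / c ^ 2 * n ^ 2 := by
    rw [div_mul_eq_mul_div, le_div_iff₀ (by positivity), ← hsq]
    have : 0 ≤ c * √(p : ℝ) := by positivity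
    nlinarith
  have h3 : Real.log p ≤ Real.log (4 / c ^ 2) + 2 * Real.log n := by
    have := Real.log_le_log (by linarith) h2
    rwa [Real.log_mul (by positivity) (by positivity), Real.log_pow] at this
  have hL1 : 1 ≤ logOne n := le_max_left _ _
  have hL2 : Real.log n ≤ logOne n := le_max_right _ _
  have h4 : Real.log p ≤ (|Real.log (4 / c ^ 2)| + 2) * logOne n := by
    have := le_abs_self (Real.log (4 / c ^ 2))
    nlinarith [abs_nonneg (Real.log (4 / c ^ 2))]
  rw [div_mul_eq_mul_div, le_div_iff₀ hcpos]
  calc (p : ℝ) * c = c * p := mul_comm _ _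
    _ ≤ n * Real.log p := h
    _ ≤ n * ((|Real.log (4 / c ^ 2)| + 2) * logOne n) := by gcongr
    _ = _ := by ring

/-! ### Positive lower density of differences of primes. -/

open Finset in
/-- Lower bound for the number of pairs of primes counted by their difference. -/
theorem card_primesBelow_sq_le (X : ℕ) (hX : 2 ≤ #X.primesBelow) :
    (#X.primesBelow : ℝ) ^ 2 / 4 ≤
      ∑ d ∈ Icc 1 X, (#{n ∈ range X | n.Prime ∧ (n + d).Prime} : ℝ) := by
  classical
  set P := X.primesBelow with hP
  set U := P.offDiag.filter fun x => x.1 < x.2 with hU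
  have hsym : #(P.offDiag.filter fun x => ¬ x.1 < x.2) ≤ #U := by
    refine card_le_card_of_injOn Prod.swap ?_ (Prod.swap_injective.injOn)
    intro x hx
    simp only [hU, coe_filter, mem_offDiag, Set.mem_ofPred_eq, Prod.fst_swap, Prod.snd_swap] at hx ⊢
    refine ⟨⟨hx.1.2.1, hx.1.1, fun h => hx.1.2.2 h.symm⟩, ?_⟩
    have := hx.1.2.2
    omega
  have htot : #U + #(P.offDiag.filter fun x => ¬ x.1 < x.2) = #P.offDiag :=
    card_filter_add_card_filter_not _
  rw [offDiag_card] at htot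
  have hUle : #U ≤ ∑ d ∈ Icc 1 X, #{n ∈ range X | n.Prime ∧ (n + d).Prime} := by
    have hmaps : ∀ x ∈ U, x.2 - x.1 ∈ Icc 1 X := by
      intro x hx
      simp only [hU, hP, mem_filter, mem_offDiag, Nat.mem_primesBelow] at hx
      exact mem_Icc.2 ⟨by omega, by omega⟩
    rw [card_eq_sum_card_fiberwise hmaps]
    refine sum_le_sum fun d hd => ?_
    refine card_le_card_of_injOn Prod.fst ?_ ?_
    · intro x hx
      simp only [hU, hP, coe_filter, mem_filter, mem_offDiag, Nat.mem_primesBelow, Set.mem_ofPred_eq,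
        mem_range] at hx ⊢
      refine ⟨hx.1.1.1.1, hx.1.1.1.2, ?_⟩
      have : x.1 + d = x.2 := by omega
      rw [this]
      exact hx.1.1.2.1.2
    · intro x hx y hy h
      simp only [hU, coe_filter, mem_filter, mem_offDiag, Set.mem_ofPred_eq] at hx hy
      refine Prod.ext h ?_
      omega
  have h1 : #P * #P ≤ 2 * #U + #P := by omega
  have h2 : (#P : ℝ) * #P ≤ 2 * #U + #P := by exact_mod_cast h1
  have h3 : (#U : ℝ) ≤ ∑ d ∈ Icc 1 X, (#{n ∈ range X | n.Prime ∧ (n + d).Prime} : ℝ) := by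
    exact_mod_cast hUle
  have h4 : (2 : ℝ) ≤ #P := by exact_mod_cast hX
  nlinarith

theorem div_totient_two_mul_le (d : ℕ) (hd : d ≠ 0) :
    (((2 * d : ℕ) : ℝ) / (2 * d).totient) ≤ 2 * (d / d.totient) := by
  have h1 : d.totient ≤ (2 * d).totient := by
    simpa using Nat.totient_super_multiplicative 2 d
  have h2 : 0 < d.totient := Nat.totient_pos.2 (by omega)
  push_cast
  rw [mul_div_assoc]
  gcongr

-- The number of prime pairs below X = Y¹⁶ is at least of order (X / log Y)², while each difference
-- d accounts for at most 4X (d/φ(d)) / log² Y of them. The logarithms cancel.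
open Finset in
theorem exists_sum_div_totient_ge : ∃ c : ℝ, 0 < c ∧ ∀ Y : ℕ, 2 ≤ Y →
    c * (Y : ℝ) ^ 16 ≤ ∑ d ∈ Icc 1 (Y ^ 16) with
      ∃ n < Y ^ 16, n.Prime ∧ (n + d).Prime, (d : ℝ) / d.totient := by
  classical
  set c := Real.log (4 / 3) / 2 with hc
  have hcpos : 0 < c := div_pos (Real.log_pos (by norm_num)) (by norm_num)
  refine ⟨c ^ 2 / 4096, by positivity, fun Y hY => ?_⟩
  have hY1 : (1 : ℝ) < Y := by exact_mod_cast hY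
  have hlog : 0 < Real.log Y := Real.log_pos hY1
  have hlogY : Real.log Y ≤ Y := Real.log_le_self (by linarith)
  obtain ⟨X, hX⟩ : ∃ X : ℕ, X = Y ^ 16 := ⟨_, rfl⟩
  have hXr : (X : ℝ) = (Y : ℝ) ^ 16 := by rw [hX]; push_cast; rfl
  have hX4 : 4 ≤ X := by
    rw [hX]
    calc 4 ≤ 2 ^ 16 := by norm_num
      _ ≤ Y ^ 16 := Nat.pow_le_pow_left hY 16
  have hXpos : (0 : ℝ) < X := by exact_mod_cast (by omega : 0 < X)
  have hXnp : ¬ X.Prime := by rw [hX]; exact Nat.Prime.not_prime_pow (by norm_num)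
  have hπ : #X.primesBelow = Nat.primeCounting X := by
    rw [Nat.primesBelow_card_eq_primeCounting']
    unfold Nat.primeCounting Nat.primeCounting'
    rw [Nat.count_succ, if_neg hXnp, add_zero]
  have h2 : 2 ≤ #X.primesBelow := by
    have : ({2, 3} : Finset ℕ) ⊆ X.primesBelow := by
      intro p hp
      rw [Nat.mem_primesBelow]
      rcases mem_insert.1 hp with rfl | hp
      · exact ⟨by omega, Nat.prime_two⟩
      · rw [mem_singleton.1 hp]
        exact ⟨by omega, Nat.prime_three⟩
    exact card_le_card this
  have hπge : c * X / (16 * Real.log Y) ≤ #X.primesBelow := by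
    rw [hπ]
    have := mul_div_log_le_primeCounting (n := X) (by omega)
    rw [hXr, Real.log_pow] at this
    rw [hXr]
    exact_mod_cast this
  have hlow := card_primesBelow_sq_le X h2
  have hup : ∀ d ∈ Icc 1 X, (#{n ∈ range X | n.Prime ∧ (n + d).Prime} : ℝ) ≤
      if ∃ n < X, n.Prime ∧ (n + d).Prime then 4 * X / Real.log Y ^ 2 * (d / d.totient) else 0 := by
    intro d hd
    have hd1 := (mem_Icc.1 hd).1
    split_ifs with h
    · have h3 := card_prime_pairs_le d Y (by omega) hY
      rw [← hX, ← hXr] at h3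
      have h4 := div_totient_two_mul_le d (by omega)
      have h5 : (1 : ℝ) ≤ d / d.totient := by
        rw [one_le_div (by exact_mod_cast Nat.totient_pos.2 (by omega))]
        exact_mod_cast Nat.totient_le d
      -- The exponent 16 makes the sieve error Y¹² negligible against X / log² Y.
      have h6 : (Y : ℝ) ^ 12 ≤ X / Real.log Y ^ 2 := by
        rw [le_div_iff₀ (by positivity), hXr]
        calc (Y : ℝ) ^ 12 * Real.log Y ^ 2 ≤ (Y : ℝ) ^ 12 * (Y : ℝ) ^ 2 := by gcongr
          _ = (Y : ℝ) ^ 14 := by ring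
          _ ≤ (Y : ℝ) ^ 16 := pow_le_pow_right₀ hY1.le (by norm_num)
      have h7 : (X : ℝ) * ((2 * d : ℕ) / (2 * d).totient) / Real.log Y ^ 2 ≤
          X * (2 * (d / d.totient)) / Real.log Y ^ 2 := by gcongr
      have h8 : (X : ℝ) / Real.log Y ^ 2 ≤ X / Real.log Y ^ 2 * (d / d.totient) :=
        le_mul_of_one_le_right (by positivity) h5
      calc _ ≤ _ := h3
        _ ≤ (X : ℝ) * (2 * (d / d.totient)) / Real.log Y ^ 2 +
          2 * (X / Real.log Y ^ 2 * (d / d.totient)) := by linarith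
        _ = _ := by ring
    · refine le_of_eq (Nat.cast_eq_zero.2 (card_eq_zero.2 (filter_eq_empty_iff.2 ?_)))
      exact fun n hn h' => h ⟨n, mem_range.1 hn, h'⟩
  rw [← hX, ← hXr]
  have h3 := hlow.trans (sum_le_sum hup)
  rw [← sum_filter, ← mul_sum] at h3
  set σ := ∑ d ∈ Icc 1 X with ∃ n < X, n.Prime ∧ (n + d).Prime, (d : ℝ) / d.totient
  have h4 : (c * X / (16 * Real.log Y)) ^ 2 / 4 ≤ 4 * X / Real.log Y ^ 2 * σ := by
    refine le_trans ?_ h3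
    gcongr
  have h5 : (c * X / (16 * Real.log Y)) ^ 2 / 4 =
      4 * X / Real.log Y ^ 2 * (c ^ 2 / 4096 * X) := by
    field_simp
    norm_num
  rw [h5] at h4
  exact le_of_mul_le_mul_left h4 (by positivity)

-- With κ = 2C/c the second moment shows that the d with d/φ(d) > κ carry at most half of the sum.
-- Each remaining d contributes at most κ, so there are at least cX/(2κ) of them.
open Finset Classical in
theorem exists_card_primeDifference_ge : ∃ κ b : ℝ, 0 < κ ∧ 0 < b ∧ ∀ Y : ℕ, 2 ≤ Y →
    b * (Y : ℝ) ^ 16 ≤ (#(filter (fun d : ℕ => (d : ℝ) / d.totient ≤ κ ∧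
      ∃ n < Y ^ 16, n.Prime ∧ (n + d).Prime) (Icc 1 (Y ^ 16))) : ℝ) := by
  obtain ⟨c, hc, hsum⟩ := exists_sum_div_totient_ge
  obtain ⟨C, hCpos, hC⟩ : ∃ C : ℝ, 0 < C ∧ ∀ X : ℕ,
      ∑ d ∈ Icc 1 X, ((d : ℝ) / d.totient) ^ 2 ≤ C * X :=
    ⟨_, Real.exp_pos _, sum_Icc_sq_div_totient_le⟩
  obtain ⟨κ, hκ⟩ : ∃ κ, κ = 2 * C / c := ⟨_, rfl⟩
  have hκpos : 0 < κ := by rw [hκ]; positivity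
  refine ⟨κ, c / (2 * κ), hκpos, by positivity, fun Y hY => ?_⟩
  have h1 := hsum Y hY
  obtain ⟨X, hX⟩ : ∃ X : ℕ, X = Y ^ 16 := ⟨_, rfl⟩
  have hXr : (X : ℝ) = (Y : ℝ) ^ 16 := by rw [hX]; push_cast; rfl
  rw [← hX, ← hXr] at h1 ⊢
  set A := filter (fun d : ℕ => ∃ n < X, n.Prime ∧ (n + d).Prime) (Icc 1 X) with hA
  rw [← sum_filter_add_sum_filter_not A (fun d : ℕ => (d : ℝ) / d.totient ≤ κ)] at h1
  have hbig : ∑ d ∈ filter (fun d : ℕ => ¬ (d : ℝ) / d.totient ≤ κ) A, (d : ℝ) / d.totient ≤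
      c / 2 * X := by
    calc ∑ d ∈ filter (fun d : ℕ => ¬ (d : ℝ) / d.totient ≤ κ) A, (d : ℝ) / d.totient
        ≤ ∑ d ∈ filter (fun d : ℕ => ¬ (d : ℝ) / d.totient ≤ κ) A,
          ((d : ℝ) / d.totient) ^ 2 / κ := by
          refine sum_le_sum fun d hd => ?_
          have := (not_le.1 (mem_filter.1 hd).2).le
          rw [le_div_iff₀ hκpos, sq]
          gcongr
      _ ≤ ∑ d ∈ Icc 1 X, ((d : ℝ) / d.totient) ^ 2 / κ :=
          sum_le_sum_of_subset_of_nonneg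
            ((filter_subset _ _).trans (filter_subset _ _)) fun _ _ _ => by positivity
      _ ≤ C * X / κ := by
          rw [← sum_div]
          gcongr
          exact hC _
      _ = _ := by
          rw [hκ]
          field_simp
  have hsmall : ∑ d ∈ filter (fun d : ℕ => (d : ℝ) / d.totient ≤ κ) A, (d : ℝ) / d.totient ≤
      #(filter (fun d : ℕ => (d : ℝ) / d.totient ≤ κ) A) * κ := by
    rw [← nsmul_eq_mul]
    exact sum_le_card_nsmul _ _ _ fun d hd => (mem_filter.1 hd).2
  have h2 : c / 2 * X / κ ≤ #(filter (fun d : ℕ => (d : ℝ) / d.totient ≤ κ) A) := by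
    rw [div_le_iff₀ hκpos]
    linarith
  have h3 : c / (2 * κ) * X = c / 2 * X / κ := by field_simp
  rw [h3]
  refine h2.trans ?_
  norm_cast
  refine card_le_card fun d hd => ?_
  simp only [hA, mem_filter] at hd ⊢
  exact ⟨hd.1.1, hd.2, hd.1.2⟩

/-- The positive integers `d` with `d / φ d ≤ K` that are differences `q - p` of primes
with `q ≤ K d`. -/
def primeDifferences (K : ℕ) : Set ℕ :=
  {d | 1 ≤ d ∧ (d : ℝ) / d.totient ≤ K ∧
    ∃ p q : ℕ, p.Prime ∧ q.Prime ∧ q = p + d ∧ q ≤ K * d}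

open Finset Classical in
/-- Differences of primes have positive lower density. -/
theorem exists_primeDifferences_density : ∃ K : ℕ, ∃ c : ℝ, 0 < c ∧ ∃ X₀ : ℕ, ∀ X : ℕ, X₀ ≤ X →
    c * X ≤ (#{d ∈ Icc 1 X | d ∈ primeDifferences K} : ℝ) := by
  obtain ⟨κ, b', hκpos, hb', hYcount⟩ := exists_card_primeDifference_ge
  obtain ⟨b, hb⟩ : ∃ b, b = b' / 2 ^ 16 := ⟨_, rfl⟩
  have hbpos : 0 < b := by rw [hb]; positivity
  -- The differences d ≤ bX/2 will be discarded; for the others q ≤ 2X ≤ (4/b) d.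
  obtain ⟨K, hK⟩ : ∃ K : ℕ, max κ (4 / b) ≤ K := ⟨_, Nat.le_ceil _⟩
  refine ⟨K, b / 2, by positivity, 2 ^ 16, fun X hX => ?_⟩
  -- Passing from sixteenth powers to all X costs a factor 2¹⁶.
  obtain ⟨Y, hY2, hYX, hXY⟩ : ∃ Y : ℕ, 2 ≤ Y ∧ Y ^ 16 ≤ X ∧ X ≤ (2 * Y) ^ 16 := by
    have hY2 : 2 ≤ Nat.findGreatest (fun y => y ^ 16 ≤ X) X :=
      Nat.le_findGreatest (le_trans (by norm_num) hX) hX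
    refine ⟨Nat.findGreatest (fun y => y ^ 16 ≤ X) X, hY2,
      Nat.findGreatest_spec (P := fun y => y ^ 16 ≤ X) (m := 2)
        (le_trans (by norm_num) hX) hX, ?_⟩
    by_contra hlt
    push Not at hlt
    have h1 : 2 * Nat.findGreatest (fun y => y ^ 16 ≤ X) X ≤
        Nat.findGreatest (fun y => y ^ 16 ≤ X) X := by
      refine Nat.le_findGreatest (P := fun y => y ^ 16 ≤ X) ?_ hlt.le
      exact (Nat.le_self_pow (by norm_num) _).trans hlt.le
    omega
  have hXYr : (X : ℝ) ≤ 2 ^ 16 * (Y : ℝ) ^ 16 := by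
    rw [← mul_pow]
    exact_mod_cast hXY
  have hcount := hYcount Y hY2
  obtain ⟨Z, hZ⟩ : ∃ Z : ℕ, Z = Y ^ 16 := ⟨_, rfl⟩
  have hZr : (Z : ℝ) = (Y : ℝ) ^ 16 := by rw [hZ]; push_cast; rfl
  rw [← hZr] at hcount hXYr
  rw [← hZ] at hcount hYX
  have hbX : b * X ≤ b' * Z := by
    rw [hb, div_mul_eq_mul_div, div_le_iff₀ (by positivity)]
    nlinarith
  set A := filter (fun d : ℕ => (d : ℝ) / d.totient ≤ κ ∧
      ∃ n < Z, n.Prime ∧ (n + d).Prime) (Icc 1 Z) with hA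
  set G := {d ∈ Icc 1 X | d ∈ primeDifferences K} with hG
  have hsub : A ⊆ G ∪ Icc 1 ⌊b * X / 2⌋₊ := by
    intro d hd
    rw [hA, mem_filter, mem_Icc] at hd
    obtain ⟨⟨hd1, hdX⟩, hdκ, n, hn, hnp, hndp⟩ := hd
    rw [mem_union]
    by_cases h : d ≤ ⌊b * X / 2⌋₊
    · exact Or.inr (mem_Icc.2 ⟨hd1, h⟩)
    · left
      have h' := Nat.lt_of_floor_lt (not_le.1 h)
      refine mem_filter.2 ⟨mem_Icc.2 ⟨hd1, hdX.trans hYX⟩, hd1,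
        hdκ.trans ((le_max_left _ _).trans hK), n, n + d, hnp, hndp, rfl, ?_⟩
      have h1 : ((n + d : ℕ) : ℝ) ≤ 2 * X := by
        have : n + d ≤ 2 * X := by omega
        exact_mod_cast this
      have h2 : 4 / b ≤ (K : ℝ) := (le_max_right _ _).trans hK
      have h3 : (2 : ℝ) * X ≤ 4 / b * d := by
        rw [div_mul_eq_mul_div, le_div_iff₀ hbpos]
        linarith
      have h4 : ((n + d : ℕ) : ℝ) ≤ K * d :=
        h1.trans (h3.trans (mul_le_mul_of_nonneg_right h2 (by positivity)))
      exact_mod_cast h4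
  have h1 := (card_le_card hsub).trans (card_union_le _ _)
  rw [Nat.card_Icc, Nat.add_sub_cancel] at h1
  have h2 : (⌊b * X / 2⌋₊ : ℝ) ≤ b * X / 2 := Nat.floor_le (by positivity)
  have h3 : (#A : ℝ) ≤ #G + ⌊b * X / 2⌋₊ := by exact_mod_cast h1
  linarith

/-! ### Torsion points on the circle that lie close together. -/

theorem exists_int_div_of_nsmul_eq_zero {L : ℕ} (hL : 0 < L) {w : UnitAddCircle}
    (hw : L • w = 0) :
    ∃ k : ℤ, (((k : ℝ) / L : ℝ) : UnitAddCircle) = w ∧ |(k : ℝ)| = L * ‖w‖ := by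
  obtain ⟨x, rfl⟩ := QuotientAddGroup.mk_surjective w
  have hL0 : (0 : ℝ) < L := by exact_mod_cast hL
  change L • (x : UnitAddCircle) = 0 at hw
  rw [← AddCircle.coe_nsmul, AddCircle.coe_eq_zero_iff] at hw
  obtain ⟨m, hm⟩ := hw
  have hm' : (m : ℝ) = L * x := by simpa using hm
  refine ⟨m - L * round x, ?_, ?_⟩
  · have : (((m - L * round x : ℤ) : ℝ) / L) = x - round x := by
      push_cast
      rw [hm']
      field_simp
    rw [this]
    change ((x - round x : ℝ) : UnitAddCircle) = (x : UnitAddCircle)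
    rw [AddCircle.coe_sub, sub_eq_self, AddCircle.coe_eq_zero_iff]
    exact ⟨round x, by simp⟩
  · change _ = L * ‖(x : UnitAddCircle)‖
    rw [UnitAddCircle.norm_eq]
    push_cast
    rw [hm', ← mul_sub, abs_mul, abs_of_pos hL0]

-- These are nonzero multiples of 1/L. Excluding 0 is what avoids an additional +1, so the bound
-- stays useful when ΔL < 1.
open Finset in
theorem card_torsion_norm_lt_le {L : ℕ} (hL : 0 < L) {Δ : ℝ} (hΔ : 0 ≤ Δ)
    (A : Finset UnitAddCircle) (hA : ∀ w ∈ A, L • w = 0 ∧ w ≠ 0 ∧ ‖w‖ < Δ) :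
    (#A : ℝ) ≤ 2 * Δ * L := by
  classical
  set m := ⌊Δ * L⌋₊ with hm
  have hsub : A ⊆ ((Icc (-(m : ℤ)) m).erase 0).image
      (fun k : ℤ => (((k : ℝ) / L : ℝ) : UnitAddCircle)) := by
    intro w hw
    obtain ⟨h1, h2, h3⟩ := hA w hw
    obtain ⟨k, hk, hkn⟩ := exists_int_div_of_nsmul_eq_zero hL h1
    refine mem_image.2 ⟨k, mem_erase.2 ⟨?_, ?_⟩, hk⟩
    · rintro rfl
      apply h2
      rw [← hk]
      simp
    · have h4 : (k.natAbs : ℝ) ≤ Δ * L := by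
        rw [Nat.cast_natAbs, Int.cast_abs, hkn, mul_comm Δ]
        gcongr
      have h5 : k.natAbs ≤ m := Nat.le_floor h4
      rw [mem_Icc]
      omega
  have h1 := (card_le_card hsub).trans card_image_le
  rw [card_erase_of_mem (mem_Icc.2 ⟨by omega, by omega⟩), Int.card_Icc] at h1
  have h2 : #A ≤ 2 * m := by omega
  have h3 : (m : ℝ) ≤ Δ * L := Nat.floor_le (by positivity)
  have h4 : (#A : ℝ) ≤ 2 * m := by exact_mod_cast h2
  linarith

open Classical in
/-- The points of exact order `n` on the circle. -/
noncomputable def orderPoints (n : ℕ) : Finset UnitAddCircle :=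
  if h : 0 < n then (AddCircle.finite_setOfPred_addOrderOf_eq (p := (1 : ℝ)) h).toFinset else ∅

theorem mem_orderPoints {n : ℕ} (hn : 0 < n) {y : UnitAddCircle} :
    y ∈ orderPoints n ↔ addOrderOf y = n := by
  rw [orderPoints, dif_pos hn]
  simp

theorem card_orderPoints {n : ℕ} (hn : 0 < n) : (orderPoints n).card = n.totient := by
  rw [← AddCircle.card_addOrderOf_eq_totient (p := (1 : ℝ)) (n := n),
    orderPoints, dif_pos hn]
  exact (Nat.card_eq_card_finite_toFinset
    (AddCircle.finite_setOfPred_addOrderOf_eq (p := (1 : ℝ)) hn)).symm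

-- Two pairs with equal difference are translates of each other by a point killed by both d and e,
-- hence by their gcd.
open Finset in
theorem card_orderPoints_sub_eq_le {d e : ℕ} (hd : 0 < d) (w : UnitAddCircle)
    (A : Finset (UnitAddCircle × UnitAddCircle))
    (hA : ∀ x ∈ A, d • x.1 = 0 ∧ e • x.2 = 0 ∧ x.1 - x.2 = w) : #A ≤ d.gcd e := by
  classical
  have hg : 0 < d.gcd e := Nat.gcd_pos_of_pos_left _ hd
  rcases A.eq_empty_or_nonempty with rfl | ⟨x₀, hx₀⟩
  · simp
  have hfin := AddCircle.finite_torsion (1 : ℝ) hg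
  have hcard : #hfin.toFinset ≤ d.gcd e := by
    have h := AddCircle.card_torsion_le_of_isSMulRegular (1 : ℝ) (d.gcd e) hg.ne'
      (IsSMulRegular.of_ne_zero (by exact_mod_cast hg.ne'))
    rw [hfin.encard_eq_coe_toFinset_card] at h
    exact_mod_cast h
  refine le_trans (card_le_card_of_injOn (fun x => x.1 - x₀.1) ?_ ?_) hcard
  · intro x hx
    obtain ⟨h1, h2, h3⟩ := hA x hx
    obtain ⟨h1', h2', h3'⟩ := hA x₀ hx₀
    simp only [Set.Finite.coe_toFinset, Set.mem_ofPred_eq]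
    rw [← addOrderOf_dvd_iff_nsmul_eq_zero]
    refine Nat.dvd_gcd ?_ ?_
    · rw [addOrderOf_dvd_iff_nsmul_eq_zero, nsmul_sub, h1, h1', sub_zero]
    · have : x.1 - x₀.1 = x.2 - x₀.2 := by
        rw [sub_eq_iff_eq_add] at h3 h3'
        rw [h3, h3']
        abel
      rw [addOrderOf_dvd_iff_nsmul_eq_zero, this, nsmul_sub, h2, h2', sub_zero]
  · intro x hx x' hx' h
    have h1 : x.1 = x'.1 := sub_left_injective h
    obtain ⟨-, -, h3⟩ := hA x hx
    obtain ⟨-, -, h3'⟩ := hA x' hx'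
    refine Prod.ext h1 ?_
    rw [← h3', h1] at h3
    exact sub_right_injective h3

open Finset in
/-- The number of pairs of distinct points of orders `d` and `e` at distance less than `Δ`. -/
theorem card_orderPoints_close_le {d e : ℕ} (hd : 0 < d) (he : 0 < e) {Δ : ℝ} (hΔ : 0 ≤ Δ)
    (A : Finset (UnitAddCircle × UnitAddCircle))
    (hA : ∀ x ∈ A, d • x.1 = 0 ∧ e • x.2 = 0 ∧ x.1 ≠ x.2 ∧ ‖x.1 - x.2‖ < Δ) :
    (#A : ℝ) ≤ 2 * Δ * (d * e) := by
  classical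
  -- Differences are lcm-torsion and each value occurs at most gcd times; gcd · lcm = de removes any
  -- dependence on common factors.
  have h1 : #A ≤ d.gcd e * #(A.image fun x => x.1 - x.2) := by
    refine card_le_mul_card_image A _ fun w _ => ?_
    refine card_orderPoints_sub_eq_le hd w _ fun x hx => ?_
    rw [mem_filter] at hx
    exact ⟨(hA x hx.1).1, (hA x hx.1).2.1, hx.2⟩
  have h2 := card_torsion_norm_lt_le (Nat.lcm_pos hd he) hΔ (A.image fun x => x.1 - x.2) (by
    intro w hw
    obtain ⟨x, hx, rfl⟩ := mem_image.1 hw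
    obtain ⟨h1, h2, h3, h4⟩ := hA x hx
    refine ⟨?_, sub_ne_zero.2 h3, h4⟩
    rw [nsmul_sub, addOrderOf_dvd_iff_nsmul_eq_zero.1
      ((addOrderOf_dvd_iff_nsmul_eq_zero.2 h1).trans (Nat.dvd_lcm_left d e)),
      addOrderOf_dvd_iff_nsmul_eq_zero.1
      ((addOrderOf_dvd_iff_nsmul_eq_zero.2 h2).trans (Nat.dvd_lcm_right d e)), sub_zero])
  have h3 : ((d.gcd e : ℕ) : ℝ) * (d.lcm e : ℕ) = d * e := by
    exact_mod_cast Nat.gcd_mul_lcm d e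
  calc (#A : ℝ) ≤ (d.gcd e : ℕ) * (#(A.image fun x => x.1 - x.2) : ℝ) := by exact_mod_cast h1
    _ ≤ (d.gcd e : ℕ) * (2 * Δ * (d.lcm e : ℕ)) := by gcongr
    _ = 2 * Δ * (d * e) := by rw [← h3]; ring

/-! ### Second moment method and a Khintchine type theorem. -/

open Finset in
/-- The second moment bound for the measure of a finite union. -/
theorem sq_sum_measureReal_le {Ω ι : Type*} [MeasurableSpace Ω] (μ : Measure Ω)
    [IsProbabilityMeasure μ] (I : Finset ι) (S : ι → Set Ω) (hS : ∀ i ∈ I, MeasurableSet (S i)) :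
    (∑ i ∈ I, μ.real (S i)) ^ 2 ≤
      (∑ i ∈ I, ∑ j ∈ I, μ.real (S i ∩ S j)) * μ.real (⋃ i ∈ I, S i) := by
  set U := ⋃ i ∈ I, S i with hU
  have hUm : MeasurableSet U := I.measurableSet_biUnion hS
  set M := ∑ i ∈ I, μ.real (S i) with hM
  set Q := ∑ i ∈ I, ∑ j ∈ I, μ.real (S i ∩ S j) with hQ
  have hint : ∀ {s : Set Ω}, MeasurableSet s → Integrable (s.indicator (1 : Ω → ℝ)) μ :=
    fun hs => (integrable_const (1 : ℝ)).indicator hs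
  -- This is the integral of (∑ 1_{S i} - t 1_U)²; the choice t = M/μ(U) below is optimal.
  have key : ∀ t : ℝ, 0 ≤ Q - 2 * t * M + t ^ 2 * μ.real U := by
    intro t
    have heq : ∀ x, (∑ i ∈ I, (S i).indicator (1 : Ω → ℝ) x - t * U.indicator 1 x) ^ 2 =
        ∑ i ∈ I, ∑ j ∈ I, (S i ∩ S j).indicator (1 : Ω → ℝ) x -
          2 * t * ∑ i ∈ I, (S i).indicator (1 : Ω → ℝ) x + t ^ 2 * U.indicator 1 x := by
      intro x
      have h1 : (∑ i ∈ I, (S i).indicator (1 : Ω → ℝ) x) * U.indicator 1 x =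
          ∑ i ∈ I, (S i).indicator (1 : Ω → ℝ) x := by
        rw [sum_mul]
        refine sum_congr rfl fun i hi => ?_
        by_cases hx : x ∈ S i
        · have hxU : x ∈ U := Set.mem_iUnion₂_of_mem hi hx
          rw [Set.indicator_of_mem hx, Set.indicator_of_mem hxU]
          simp
        · rw [Set.indicator_of_notMem hx, zero_mul]
      have h2 : U.indicator (1 : Ω → ℝ) x * U.indicator 1 x = U.indicator 1 x := by
        by_cases hx : x ∈ U <;> simp [hx]
      have h3 : (∑ i ∈ I, (S i).indicator (1 : Ω → ℝ) x) * ∑ i ∈ I, (S i).indicator (1 : Ω → ℝ) x =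
          ∑ i ∈ I, ∑ j ∈ I, (S i ∩ S j).indicator (1 : Ω → ℝ) x := by
        rw [sum_mul_sum]
        refine sum_congr rfl fun i _ => sum_congr rfl fun j _ => ?_
        rw [Set.inter_indicator_one, Pi.mul_apply]
      linear_combination h3 - 2 * t * h1 + t ^ 2 * h2
    have h0 : 0 ≤ ∫ x, (∑ i ∈ I, (S i).indicator (1 : Ω → ℝ) x - t * U.indicator 1 x) ^ 2 ∂μ :=
      integral_nonneg fun x => sq_nonneg _
    simp_rw [heq] at h0
    have i1 : Integrable (fun x => ∑ i ∈ I, ∑ j ∈ I, (S i ∩ S j).indicator (1 : Ω → ℝ) x) μ :=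
      integrable_finsetSum _ fun i hi => integrable_finsetSum _ fun j hj =>
        hint ((hS i hi).inter (hS j hj))
    have i2 : Integrable (fun x => ∑ i ∈ I, (S i).indicator (1 : Ω → ℝ) x) μ :=
      integrable_finsetSum _ fun i hi => hint (hS i hi)
    have i12 : Integrable (fun x => ∑ i ∈ I, ∑ j ∈ I, (S i ∩ S j).indicator (1 : Ω → ℝ) x -
        2 * t * ∑ i ∈ I, (S i).indicator (1 : Ω → ℝ) x) μ := i1.sub (i2.const_mul _)
    rw [integral_add i12 ((hint hUm).const_mul _),
      integral_sub i1 (i2.const_mul _), integral_const_mul, integral_const_mul,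
      integral_indicator_one hUm, integral_finsetSum _ fun i hi => hint (hS i hi),
      integral_finsetSum _ fun i hi => integrable_finsetSum _ fun j hj =>
        hint ((hS i hi).inter (hS j hj))] at h0
    rw [sum_congr rfl fun i hi => integral_indicator_one (hS i hi),
      sum_congr rfl fun i hi => (integral_finsetSum _ fun j hj =>
        hint ((hS i hi).inter (hS j hj))).trans
          (sum_congr rfl fun j hj => integral_indicator_one ((hS i hi).inter (hS j hj)))] at h0
    exact h0
  rcases (measureReal_nonneg (μ := μ) (s := U)).eq_or_lt with h0 | hpos
  · have hM0 : M = 0 := sum_eq_zero fun i hi => le_antisymm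
      (h0 ▸ measureReal_mono (Set.subset_iUnion₂_of_subset i hi subset_rfl) (measure_ne_top _ _))
        measureReal_nonneg
    rw [hM0, ← h0]
    simp
  · have h := key (M / μ.real U)
    have h' : Q - 2 * (M / μ.real U) * M + (M / μ.real U) ^ 2 * μ.real U =
        Q - M ^ 2 / μ.real U := by field_simp; ring
    rw [h', sub_nonneg, div_le_iff₀ hpos] at h
    exact h

theorem volume_real_ball_unitAddCircle (y : UnitAddCircle) {δ : ℝ} (h0 : 0 ≤ δ) (h1 : δ ≤ 1 / 2) :
    (volume : Measure UnitAddCircle).real (Metric.ball y δ) = 2 * δ := by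
  rw [measureReal_congr (AddCircle.closedBall_ae_eq_ball (x := y) (ε := δ)).symm, Measure.real,
    AddCircle.volume_closedBall, min_eq_right (by linarith), ENNReal.toReal_ofReal (by linarith)]

theorem volume_real_ball_inter_ball_le (y y' : UnitAddCircle) {δ δ' : ℝ} (h0 : 0 ≤ δ)
    (h1 : δ ≤ 1 / 2) (h0' : 0 ≤ δ') (h1' : δ' ≤ 1 / 2) :
    (volume : Measure UnitAddCircle).real (Metric.ball y δ ∩ Metric.ball y' δ') ≤
      if ‖y - y'‖ < δ + δ' then 2 * min δ δ' else 0 := by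
  split_ifs with h
  · rw [mul_min_of_nonneg _ _ (by norm_num), le_min_iff]
    constructor
    · rw [← volume_real_ball_unitAddCircle y h0 h1]
      exact measureReal_mono Set.inter_subset_left
    · rw [← volume_real_ball_unitAddCircle y' h0' h1']
      exact measureReal_mono Set.inter_subset_right
  · have : Metric.ball y δ ∩ Metric.ball y' δ' = ∅ := by
      ext x
      simp only [Set.mem_inter_iff, Metric.mem_ball, Set.mem_empty_iff_false, iff_false, not_and]
      intro hx hx'
      apply h
      rw [← dist_eq_norm]
      calc dist y y' ≤ dist x y + dist x y' := by rw [dist_comm x y]; exact dist_triangle _ _ _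
        _ < δ + δ' := add_lt_add hx hx'
    rw [this]
    simp

open Finset in
/-- Quasi-independence of the sets of points close to points of order `d`. -/
theorem sum_volume_real_inter_le {d e : ℕ} (hd : 0 < d) (he : 0 < e) {s t : ℝ} (hs : 0 ≤ s)
    (hs1 : s ≤ 1 / 2) (ht : 0 ≤ t) (ht1 : t ≤ 1 / 2) :
    ∑ y ∈ orderPoints d, ∑ y' ∈ orderPoints e,
      (volume : Measure UnitAddCircle).real (Metric.ball y (s / d) ∩ Metric.ball y' (t / e)) ≤
      (if d = e then 2 * s else 0) + 8 * (s * t) := by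
  classical
  have hd1 : (1 : ℝ) ≤ d := by exact_mod_cast hd
  have he1 : (1 : ℝ) ≤ e := by exact_mod_cast he
  have hd0 : (0 : ℝ) < d := by linarith
  have he0 : (0 : ℝ) < e := by linarith
  have a0 : 0 ≤ s / d := by positivity
  have b0 : 0 ≤ t / e := by positivity
  have a1 : s / d ≤ 1 / 2 := (div_le_self hs hd1).trans hs1
  have b1 : t / e ≤ 1 / 2 := (div_le_self ht he1).trans ht1
  set a := s / d with ha
  set b := t / e with hb
  have hmin0 : 0 ≤ min a b := le_min a0 b0
  calc ∑ y ∈ orderPoints d, ∑ y' ∈ orderPoints e,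
      (volume : Measure UnitAddCircle).real (Metric.ball y a ∩ Metric.ball y' b)
      ≤ ∑ y ∈ orderPoints d, ∑ y' ∈ orderPoints e,
        ((if y = y' then 2 * a else 0) +
          (if y ≠ y' ∧ ‖y - y'‖ < a + b then 2 * min a b else 0)) := by
        refine sum_le_sum fun y _ => sum_le_sum fun y' _ => ?_
        have h := volume_real_ball_inter_ball_le y y' a0 a1 b0 b1
        by_cases hy : y = y'
        · rw [if_pos hy, if_neg (fun h => h.1 hy), add_zero]
          refine h.trans ?_
          split_ifs
          · linarith [min_le_left a b]
          · positivity
        · rw [if_neg hy, zero_add]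
          refine h.trans (le_of_eq ?_)
          simp only [ne_eq, hy, not_false_eq_true, true_and]
    _ = ∑ y ∈ orderPoints d, ∑ y' ∈ orderPoints e, (if y = y' then 2 * a else 0) +
        ∑ y ∈ orderPoints d, ∑ y' ∈ orderPoints e,
          (if y ≠ y' ∧ ‖y - y'‖ < a + b then 2 * min a b else 0) := by
        simp_rw [sum_add_distrib]
    _ ≤ _ := by
        refine add_le_add ?_ ?_
        · split_ifs with hde
          · subst hde
            calc ∑ y ∈ orderPoints d, ∑ y' ∈ orderPoints d, (if y = y' then 2 * a else 0)
                = (d.totient : ℝ) * (2 * a) := by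
                  simp_rw [sum_ite_eq]
                  rw [← card_orderPoints hd, ← nsmul_eq_mul, ← sum_const]
                  exact sum_congr rfl fun y hy => by rw [if_pos hy]
              _ ≤ d * (2 * a) := by
                  gcongr
                  exact Nat.totient_le d
              _ = 2 * s := by rw [ha]; field_simp
          · refine le_of_eq (sum_eq_zero fun y hy => sum_eq_zero fun y' hy' => if_neg ?_)
            rintro rfl
            rw [mem_orderPoints hd] at hy
            rw [mem_orderPoints he] at hy'
            exact hde (hy.symm.trans hy')
        · rw [← sum_product' (f := fun y y' : UnitAddCircle =>
            (if y ≠ y' ∧ ‖y - y'‖ < a + b then 2 * min a b else 0)), ← sum_filter, sum_const,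
            nsmul_eq_mul]
          have hc := card_orderPoints_close_le hd he (Δ := a + b) (by positivity)
            ((orderPoints d ×ˢ orderPoints e).filter
              fun x => x.1 ≠ x.2 ∧ ‖x.1 - x.2‖ < a + b) (by
            intro x hx
            rw [mem_filter, mem_product, mem_orderPoints hd, mem_orderPoints he] at hx
            exact ⟨hx.1.1 ▸ addOrderOf_nsmul_eq_zero _, hx.1.2 ▸ addOrderOf_nsmul_eq_zero _, hx.2⟩)
          -- The number of close pairs scales with a + b and each overlap with min a b, so the total
          -- is of the order of the product.
          have hab : (a + b) * min a b ≤ 2 * (a * b) := by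
            rcases le_total a b with h | h
            · rw [min_eq_left h]; nlinarith
            · rw [min_eq_right h]; nlinarith
          calc _ ≤ 2 * (a + b) * (d * e) * (2 * min a b) := by gcongr
            _ = 4 * (d * e) * ((a + b) * min a b) := by ring
            _ ≤ 4 * (d * e) * (2 * (a * b)) := by gcongr
            _ = 8 * (s * t) := by rw [ha, hb]; field_simp; ring

theorem approxAddOrderOf_eq_biUnion {n : ℕ} (hn : 0 < n) (δ : ℝ) :
    approxAddOrderOf UnitAddCircle n δ = ⋃ y ∈ orderPoints n, Metric.ball y δ := by
  ext x
  simp only [mem_approx_add_orderOf_iff, Set.mem_iUnion, mem_orderPoints hn, exists_prop]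

theorem isProbabilityMeasure_volume_unitAddCircle :
    IsProbabilityMeasure (volume : Measure UnitAddCircle) := ⟨UnitAddCircle.measure_univ⟩

open Finset in
/-- A lower bound for the measure of a finite union of sets of points close to points of
given order. -/
theorem le_volume_real_biUnion_approxAddOrderOf {K : ℝ} (hK : 0 < K) (s : Finset ℕ) (θ : ℕ → ℝ)
    (hs : ∀ d ∈ s, 0 < d) (hsK : ∀ d ∈ s, (d : ℝ) / d.totient ≤ K) (h0 : ∀ d, 0 ≤ θ d)
    (h1 : ∀ d, θ d ≤ 1 / 2) (hsum : 1 ≤ ∑ d ∈ s, θ d) :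
    2 / (5 * K ^ 2) ≤ (volume : Measure UnitAddCircle).real
      (⋃ d ∈ s, approxAddOrderOf UnitAddCircle d (θ d / d)) := by
  classical
  have := isProbabilityMeasure_volume_unitAddCircle
  have hU : (⋃ d ∈ s, approxAddOrderOf UnitAddCircle d (θ d / d)) =
      ⋃ x ∈ s.sigma orderPoints, Metric.ball x.2 (θ x.1 / x.1) := by
    rw [Set.iUnion₂_congr fun d hd => approxAddOrderOf_eq_biUnion (hs d hd) (θ d / d)]
    ext x
    simp only [Set.mem_iUnion, mem_sigma, exists_prop, Sigma.exists]
    constructor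
    · rintro ⟨d, hd, y, hy, hx⟩
      exact ⟨d, y, ⟨hd, hy⟩, hx⟩
    · rintro ⟨d, y, ⟨hd, hy⟩, hx⟩
      exact ⟨d, hd, y, hy, hx⟩
  have hmain := sq_sum_measureReal_le (volume : Measure UnitAddCircle) (s.sigma orderPoints)
    (fun x => Metric.ball x.2 (θ x.1 / x.1)) fun _ _ => measurableSet_ball
  rw [← hU] at hmain
  set W := (volume : Measure UnitAddCircle).real
      (⋃ d ∈ s, approxAddOrderOf UnitAddCircle d (θ d / d)) with hW
  set σ := ∑ d ∈ s, θ d with hσ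
  have hM : 2 / K * σ ≤ ∑ x ∈ s.sigma orderPoints,
      (volume : Measure UnitAddCircle).real (Metric.ball x.2 (θ x.1 / x.1)) := by
    rw [sum_sigma, hσ, mul_sum]
    refine sum_le_sum fun d hd => ?_
    have hd1 : (1 : ℝ) ≤ d := by exact_mod_cast hs d hd
    have hφ : (0 : ℝ) < d.totient := by exact_mod_cast Nat.totient_pos.2 (hs d hd)
    have a0 : 0 ≤ θ d / d := div_nonneg (h0 d) (by linarith)
    have a1 : θ d / d ≤ 1 / 2 := (div_le_self (h0 d) hd1).trans (h1 d)
    rw [sum_congr rfl fun y _ => volume_real_ball_unitAddCircle y a0 a1, sum_const, nsmul_eq_mul,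
      card_orderPoints (hs d hd)]
    have h2 := hsK d hd
    rw [div_le_iff₀ hφ] at h2
    have h3 : 1 / K ≤ d.totient / d := by
      rw [div_le_div_iff₀ hK (by linarith)]
      linarith
    calc 2 / K * θ d = 2 * θ d * (1 / K) := by ring
      _ ≤ 2 * θ d * (d.totient / d) := mul_le_mul_of_nonneg_left h3 (by linarith [h0 d])
      _ = _ := by ring
  have hQ : ∑ x ∈ s.sigma orderPoints, ∑ x' ∈ s.sigma orderPoints,
      (volume : Measure UnitAddCircle).real
        (Metric.ball x.2 (θ x.1 / x.1) ∩ Metric.ball x'.2 (θ x'.1 / x'.1)) ≤ 10 * σ ^ 2 := by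
    rw [sum_sigma]
    simp_rw [sum_sigma]
    calc ∑ d ∈ s, ∑ y ∈ orderPoints d, ∑ e ∈ s, ∑ y' ∈ orderPoints e,
          (volume : Measure UnitAddCircle).real
            (Metric.ball y (θ d / d) ∩ Metric.ball y' (θ e / e))
        = ∑ d ∈ s, ∑ e ∈ s, ∑ y ∈ orderPoints d, ∑ y' ∈ orderPoints e,
          (volume : Measure UnitAddCircle).real
            (Metric.ball y (θ d / d) ∩ Metric.ball y' (θ e / e)) :=
          sum_congr rfl fun d _ => sum_comm
      _ ≤ ∑ d ∈ s, ∑ e ∈ s, ((if d = e then 2 * θ d else 0) + 8 * (θ d * θ e)) :=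
          sum_le_sum fun d hd => sum_le_sum fun e he =>
            sum_volume_real_inter_le (hs d hd) (hs e he) (h0 d) (h1 d) (h0 e) (h1 e)
      _ = 2 * σ + 8 * σ ^ 2 := by
          simp_rw [sum_add_distrib, sum_ite_eq, ← mul_sum]
          rw [← sum_mul, ← hσ, ← sq]
          congr 1
          rw [hσ, mul_sum]
          exact sum_congr rfl fun d hd => by rw [if_pos hd]
      -- The diagonal 2σ is absorbed because σ ≥ 1.
      _ ≤ 10 * σ ^ 2 := by nlinarith
  have hW0 : 0 ≤ W := measureReal_nonneg
  have h2 : (2 / K * σ) ^ 2 ≤ 10 * σ ^ 2 * W := by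
    refine le_trans ?_ (hmain.trans (mul_le_mul_of_nonneg_right hQ hW0))
    exact pow_le_pow_left₀ (by positivity) hM 2
  have h3 : (2 / K * σ) ^ 2 = 10 * σ ^ 2 * (2 / (5 * K ^ 2)) := by
    field_simp
    norm_num
  rw [h3] at h2
  exact le_of_mul_le_mul_left h2 (by positivity)

open Finset Filter in
/-- A Khintchine type theorem for approximation with denominators in a set `G` on which `d / φ d`
is bounded. -/
theorem ae_infinite_norm_nsmul_lt {K : ℝ} (hK : 0 < K) (G : Set ℕ)
    (hG : ∀ d ∈ G, 0 < d) (hGK : ∀ d ∈ G, (d : ℝ) / d.totient ≤ K) (θ : ℕ → ℝ) (h0 : ∀ d, 0 ≤ θ d)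
    (h1 : ∀ d, θ d ≤ 1 / 2) (hdiv : ¬ Summable (G.indicator θ)) :
    ∀ᵐ x : UnitAddCircle, {d : ℕ | d ∈ G ∧ ‖d • x‖ < θ d}.Infinite := by
  classical
  have := isProbabilityMeasure_volume_unitAddCircle
  set ψ := G.indicator θ with hψ
  have hψ0 : ∀ d, 0 ≤ ψ d := fun d => Set.indicator_nonneg (fun d _ => h0 d) d
  have hψ1 : ∀ d, ψ d ≤ 1 / 2 := fun d => by
    by_cases hd : d ∈ G
    · rw [hψ, Set.indicator_of_mem hd]; exact h1 d
    · rw [hψ, Set.indicator_of_notMem hd]; norm_num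
  set δ : ℕ → ℝ := fun d => ψ d / d with hδ
  have hδlim : Tendsto δ atTop (nhds 0) := by
    refine squeeze_zero (fun d => div_nonneg (hψ0 d) (Nat.cast_nonneg d))
      (fun d => div_le_div_of_nonneg_right (hψ1 d) (Nat.cast_nonneg d))
      (tendsto_const_div_atTop_nhds_zero_nat _)
  set E : ℕ → Set UnitAddCircle := fun d => approxAddOrderOf UnitAddCircle d (δ d) with hE
  have hopen : ∀ d, IsOpen (E d) := fun d => Metric.isOpen_thickening
  -- Thickenings are open, so radius 0 gives the empty set and indices outside G contribute nothing.
  have hemem : ∀ d x, x ∈ E d → 0 < ψ d := by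
    intro d x hx
    obtain ⟨y, -, hy⟩ := mem_approx_add_orderOf_iff.1 hx
    have h2 : 0 < δ d := lt_of_le_of_lt dist_nonneg (Metric.mem_ball.1 hy)
    by_contra h3
    have h4 : ψ d = 0 := le_antisymm (not_lt.1 h3) (hψ0 d)
    simp [hδ, h4] at h2
  have hmemG : ∀ d, 0 < ψ d → d ∈ G := fun d hd => by
    by_contra h
    rw [hψ, Set.indicator_of_notMem h] at hd
    exact hd.false
  have hpos : ∀ x, x ∈ addWellApproximable UnitAddCircle δ ↔ {d | x ∈ E d}.Infinite := by
    intro x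
    rw [mem_add_wellApproximable_iff, ← Nat.cofinite_eq_atTop, cofinite.blimsup_set_eq]
    refine iff_of_eq (congrArg Set.Infinite (Set.ext fun d => ?_))
    exact ⟨fun h => h.2, fun h => ⟨hG d (hmemG d (hemem d x h)), h⟩⟩
  set U : ℕ → Set UnitAddCircle := fun M => ⋃ d ∈ Set.Ici M, E d with hU
  have hUanti : Antitone U := fun M N h => Set.biUnion_subset_biUnion_left (Set.Ici_subset_Ici.2 h)
  have hUopen : ∀ M, IsOpen (U M) := fun M => isOpen_biUnion fun d _ => hopen d
  have hUmeas : ∀ M, 2 / (5 * K ^ 2) ≤ (volume : Measure UnitAddCircle).real (U M) := by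
    intro M
    have htend := (not_summable_iff_tendsto_nat_atTop_of_nonneg hψ0).1 hdiv
    obtain ⟨n, hnM, hn⟩ := ((eventually_ge_atTop M).and
      (htend.eventually_ge_atTop (1 + ∑ d ∈ range M, ψ d))).exists
    have hsum : 1 ≤ ∑ d ∈ Ico M n with d ∈ G, ψ d := by
      rw [sum_filter_of_ne fun d _ hd => hmemG d (lt_of_le_of_ne (hψ0 d) hd.symm),
        sum_Ico_eq_sub _ hnM]
      linarith
    have h2 := le_volume_real_biUnion_approxAddOrderOf hK (filter (· ∈ G) (Ico M n)) ψ
      (fun d hd => hG d (mem_filter.1 hd).2) (fun d hd => hGK d (mem_filter.1 hd).2) hψ0 hψ1 hsum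
    refine h2.trans (measureReal_mono ?_ (measure_ne_top _ _))
    refine Set.iUnion₂_subset fun d hd => ?_
    exact Set.subset_iUnion₂_of_subset d (mem_Ico.1 (mem_filter.1 hd).1).1 subset_rfl
  have hInter : ⋂ M, U M ⊆ addWellApproximable UnitAddCircle δ := by
    intro x hx
    rw [hpos, Set.infinite_iff_exists_gt]
    intro M
    obtain ⟨d, hd, hxd⟩ := Set.mem_iUnion₂.1 (Set.mem_iInter.1 hx (M + 1))
    exact ⟨d, hxd, Nat.lt_of_succ_le hd⟩
  have hIpos : volume (⋂ M, U M) ≠ 0 := by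
    have htend := tendsto_measure_iInter_atTop (μ := (volume : Measure UnitAddCircle))
      (fun M => (hUopen M).measurableSet.nullMeasurableSet) hUanti ⟨0, measure_ne_top _ _⟩
    have hle : ENNReal.ofReal (2 / (5 * K ^ 2)) ≤ volume (⋂ M, U M) := by
      refine ge_of_tendsto' htend fun M => ?_
      exact (ENNReal.ofReal_le_iff_le_toReal (measure_ne_top _ _)).2 (hUmeas M)
    exact (lt_of_lt_of_le (ENNReal.ofReal_pos.2 (by positivity)) hle).ne'
  -- Gallagher's zero-one law turns positive measure into full measure.
  rcases AddCircle.addWellApproximable_ae_empty_or_univ (T := (1 : ℝ)) δ hδlim with h | h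
  · refine absurd (measure_mono_null hInter ?_) hIpos
    rw [ae_iff] at h
    simpa using h
  · filter_upwards [h] with x hx
    refine ((hpos x).1 hx).mono fun d hd => ?_
    have hd' : x ∈ E d := hd
    have hψd := hemem d x hd'
    have hdG := hmemG d hψd
    refine ⟨hdG, ?_⟩
    have hd0 := hG d hdG
    have hd0' : (0 : ℝ) < d := by exact_mod_cast hd0
    rw [hE] at hd'
    simp only [approxAddOrderOf_eq_biUnion hd0, Set.mem_iUnion, mem_orderPoints hd0,
      Metric.mem_ball, dist_eq_norm, exists_prop] at hd'
    obtain ⟨y, hy, hxy⟩ := hd'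
    have h2 : d • x = d • (x - y) := by
      rw [nsmul_sub, ← hy, addOrderOf_nsmul_eq_zero, sub_zero]
    rw [h2]
    calc ‖d • (x - y)‖ ≤ d * ‖x - y‖ := norm_nsmul_le
      _ < d * δ d := by gcongr
      _ = θ d := by
        have : δ d = θ d / d := by simp only [hδ, hψ, Set.indicator_of_mem hdG]
        rw [this]
        field_simp

/-! ### Transfer to the unit interval and measurability. -/

theorem ae_Icc_of_ae_unitAddCircle {P : UnitAddCircle → Prop} (h : ∀ᵐ x : UnitAddCircle, P x) :
    ∀ᵐ α : ℝ, α ∈ Set.Icc (0 : ℝ) 1 → P α := by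
  have h1 := (UnitAddCircle.measurePreserving_mk 0).quasiMeasurePreserving.ae h
  rw [zero_add, restrict_Ioc_eq_restrict_Icc, ae_restrict_iff' measurableSet_Icc] at h1
  exact h1

theorem minGap_le_iff (a : ℕ → ℕ) (α : ℝ) {N : ℕ} (hN : 2 ≤ N) (t : ℝ) :
    minGap a α N ≤ t ↔ ∃ m n : ℕ, 1 ≤ m ∧ m ≤ N ∧ 1 ≤ n ∧ n ≤ N ∧ m ≠ n ∧
      ‖((((a m : ℝ) - (a n : ℝ)) * α : ℝ) : UnitAddCircle)‖ ≤ t := by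
  unfold minGap
  set S := {d : ℝ | ∃ m n : ℕ, 1 ≤ m ∧ m ≤ N ∧ 1 ≤ n ∧ n ≤ N ∧ m ≠ n ∧
    d = ‖((((a m : ℝ) - (a n : ℝ)) * α : ℝ) : UnitAddCircle)‖} with hS
  have hbdd : BddBelow S := ⟨0, by
    rintro d ⟨m, n, -, -, -, -, -, rfl⟩
    exact norm_nonneg _⟩
  have hne : S.Nonempty := ⟨_, 1, 2, le_rfl, by omega, by omega, hN, by omega, rfl⟩
  have hfin : S.Finite := by
    refine ((Set.finite_Iic N).prod (Set.finite_Iic N)).image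
      (fun x => ‖((((a x.1 : ℝ) - (a x.2 : ℝ)) * α : ℝ) : UnitAddCircle)‖) |>.subset ?_
    rintro d ⟨m, n, -, hm, -, hn, -, rfl⟩
    exact ⟨(m, n), ⟨hm, hn⟩, rfl⟩
  constructor
  · intro h
    obtain ⟨m, n, h1, h2, h3, h4, h5, h6⟩ := hne.csInf_mem hfin
    exact ⟨m, n, h1, h2, h3, h4, h5, h6 ▸ h⟩
  · rintro ⟨m, n, h1, h2, h3, h4, h5, h6⟩
    exact (csInf_le hbdd ⟨m, n, h1, h2, h3, h4, h5, rfl⟩).trans h6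

theorem measurableSet_minGap_le (a : ℕ → ℕ) {N : ℕ} (hN : 2 ≤ N) (t : ℝ) :
    MeasurableSet {α : ℝ | minGap a α N ≤ t} := by
  simp_rw [minGap_le_iff a _ hN t]
  have : {α : ℝ | ∃ m n : ℕ, 1 ≤ m ∧ m ≤ N ∧ 1 ≤ n ∧ n ≤ N ∧ m ≠ n ∧
      ‖((((a m : ℝ) - (a n : ℝ)) * α : ℝ) : UnitAddCircle)‖ ≤ t} =
      ⋃ m : ℕ, ⋃ n : ℕ, ⋃ _ : 1 ≤ m ∧ m ≤ N ∧ 1 ≤ n ∧ n ≤ N ∧ m ≠ n,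
        {α : ℝ | ‖((((a m : ℝ) - (a n : ℝ)) * α : ℝ) : UnitAddCircle)‖ ≤ t} := by
    ext α
    simp only [Set.mem_ofPred_eq, Set.mem_iUnion, exists_prop, and_assoc]
  rw [this]
  refine MeasurableSet.iUnion fun m => MeasurableSet.iUnion fun n => MeasurableSet.iUnion fun _ => ?_
  refine (isClosed_le (continuous_norm.comp
    ((AddCircle.continuous_mk' 1).comp (continuous_const.mul continuous_id)))
    continuous_const).measurableSet

theorem measurableSet_smallGapSet (η : ℝ → ℝ) : MeasurableSet (smallGapSet η) := by
  -- Starting at k + 2 avoids N < 2, where the set of gaps is empty and its `sInf` is the default 0.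
  have : smallGapSet η = Set.Icc 0 1 ∩ ⋂ k : ℕ, ⋃ N : ℕ, ⋃ _ : k + 2 ≤ N,
      {α : ℝ | minGap primeSeq α N ≤ η ((N : ℝ) * logOne (N : ℝ))} := by
    ext α
    simp only [smallGapSet, Set.mem_ofPred_eq, Set.mem_inter_iff, Set.mem_iInter, Set.mem_iUnion,
      Set.infinite_iff_exists_gt, exists_prop]
    refine and_congr_right fun _ => ⟨fun h k => ?_, fun h k => ?_⟩
    · obtain ⟨N, h1, h2⟩ := h (k + 1)
      exact ⟨N, h2, h1⟩
    · obtain ⟨N, h1, h2⟩ := h k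
      exact ⟨N, h2, by omega⟩
  rw [this]
  refine measurableSet_Icc.inter (MeasurableSet.iInter fun k => MeasurableSet.iUnion fun N =>
    MeasurableSet.iUnion fun hN => measurableSet_minGap_le _ (by omega) _)

/-! ### Series along dilations and along sets of positive density. -/

theorem summable_comp_div {u : ℕ → ℝ} (h0 : ∀ n, 0 ≤ u n) (hu : Summable u) {K : ℕ} (hK : 0 < K) :
    Summable fun n => u (n / K) := by
  have : NeZero K := ⟨hK.ne'⟩
  have h : Summable fun x : ℕ × Fin K => u x.1 := by
    rw [summable_prod_of_nonneg fun x => h0 _]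
    refine ⟨fun x => Summable.of_finite, ?_⟩
    simp only [tsum_const, nsmul_eq_mul]
    exact hu.mul_left _
  exact (Nat.divModEquiv K).summable_iff.2 h

/-- Abel summation: with U the partial sums of u, the right-hand side grows at each step by (U(n+1)
+ B)(θ(n) - θ(n+1)) ≥ 0, starting from -Bθ(0). -/
theorem neg_mul_le_sum_mul {u θ : ℕ → ℝ} {B : ℝ} (hθ : Antitone θ)
    (hB : ∀ n, -B ≤ ∑ d ∈ Finset.range n, u d) (n : ℕ) :
    -(B * θ 0) ≤ ∑ d ∈ Finset.range n, u d * θ d - (∑ d ∈ Finset.range n, u d + B) * θ n := by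
  induction n with
  | zero => simp
  | succ n ih =>
    rw [Finset.sum_range_succ, Finset.sum_range_succ]
    have h1 := hB (n + 1)
    rw [Finset.sum_range_succ] at h1
    have h2 := hθ (Nat.le_succ n)
    simp only [Nat.succ_eq_add_one] at h2
    nlinarith

open Finset Classical in
/-- An antitone series that diverges still diverges over a set of positive lower density. -/
theorem not_summable_indicator_of_density {θ : ℕ → ℝ} (hθ : Antitone θ) (h0 : ∀ n, 0 ≤ θ n)
    (hdiv : ¬ Summable θ) (G : Set ℕ) {c : ℝ} (hc : 0 < c) (X₀ : ℕ)
    (hG : ∀ X : ℕ, X₀ ≤ X → c * X ≤ (#{d ∈ Icc 1 X | d ∈ G} : ℝ)) :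
    ¬ Summable (G.indicator θ) := by
  intro hsum
  apply hdiv
  have hind0 : ∀ d, 0 ≤ G.indicator θ d := fun d => Set.indicator_nonneg (fun d _ => h0 d) d
  -- Density bounds the partial sums of 1_G - c below by -B, so Abel summation gives c ∑ θ ≤ ∑_G θ +
  -- Bθ(0).
  set u : ℕ → ℝ := fun d => G.indicator 1 d - c with hu
  set B := c * (X₀ + 1) with hB
  have hpart : ∀ n, -B ≤ ∑ d ∈ range n, u d := by
    intro n
    have hI0 : ∀ d, 0 ≤ G.indicator (1 : ℕ → ℝ) d :=
      fun d => Set.indicator_nonneg (fun _ _ => zero_le_one) d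
    rw [hu, sum_sub_distrib, sum_const, card_range, nsmul_eq_mul]
    have hs0 : 0 ≤ ∑ d ∈ range n, G.indicator (1 : ℕ → ℝ) d := sum_nonneg fun d _ => hI0 d
    rcases le_or_gt n (X₀ + 1) with h | h
    · have : (n : ℝ) ≤ X₀ + 1 := by exact_mod_cast h
      nlinarith
    · have h1 := hG (n - 1) (by omega)
      have h2 : (#{d ∈ Icc 1 (n - 1) | d ∈ G} : ℝ) ≤ ∑ d ∈ range n, G.indicator (1 : ℕ → ℝ) d := by
        rw [card_eq_sum_ones, Nat.cast_sum, sum_filter]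
        calc _ = ∑ d ∈ Icc 1 (n - 1), G.indicator (1 : ℕ → ℝ) d := by
              refine sum_congr rfl fun d _ => ?_
              by_cases hd : d ∈ G <;> simp [hd]
          _ ≤ _ := sum_le_sum_of_subset_of_nonneg (fun d hd => by
              rw [mem_Icc] at hd
              exact mem_range.2 (by omega)) fun d _ _ => hI0 d
      rw [Nat.cast_sub (by omega)] at h1
      push_cast at h1
      have : (0 : ℝ) ≤ X₀ := Nat.cast_nonneg _
      nlinarith
  refine (summable_mul_left_iff hc.ne').1 ?_
  refine summable_of_sum_range_le (c := ∑' d, G.indicator θ d + B * θ 0)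
    (fun n => mul_nonneg hc.le (h0 n)) fun n => ?_
  have h1 := neg_mul_le_sum_mul hθ hpart n
  have h2 : 0 ≤ (∑ d ∈ range n, u d + B) * θ n :=
    mul_nonneg (by linarith [hpart n]) (h0 n)
  have h3 : ∑ d ∈ range n, u d * θ d =
      ∑ d ∈ range n, G.indicator θ d - ∑ d ∈ range n, c * θ d := by
    rw [← sum_sub_distrib]
    refine sum_congr rfl fun d _ => ?_
    by_cases hd : d ∈ G <;> simp [hu, hd, sub_mul]
  have h4 := hsum.sum_le_tsum (range n) fun d _ => hind0 d
  linarith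

/-! ### The convergence case. -/

theorem volume_norm_nsmul_le {d : ℕ} (hd : 0 < d) (t : ℝ) :
    volume {x : UnitAddCircle | ‖d • x‖ ≤ t} ≤ ENNReal.ofReal (2 * t) := by
  have hmp : MeasurePreserving (fun x : UnitAddCircle => d • x) := by
    rcases Nat.lt_or_ge 1 d with h | h
    · exact (AddCircle.ergodic_nsmul h).toMeasurePreserving
    · have : d = 1 := by omega
      subst this
      simp only [one_smul]
      exact MeasurePreserving.id _
  have : {x : UnitAddCircle | ‖d • x‖ ≤ t} =
      (fun x : UnitAddCircle => d • x) ⁻¹' Metric.closedBall 0 t := by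
    ext x
    simp
  rw [this, hmp.measure_preimage Metric.isClosed_closedBall.measurableSet.nullMeasurableSet,
    AddCircle.volume_closedBall]
  exact ENNReal.ofReal_le_ofReal (min_le_right _ _)

theorem ae_nsmul_ne_zero : ∀ᵐ x : UnitAddCircle, ∀ d : ℕ, 0 < d → d • x ≠ 0 := by
  rw [ae_all_iff]
  intro d
  by_cases hd : 0 < d
  · have h := volume_norm_nsmul_le hd 0
    rw [mul_zero, ENNReal.ofReal_zero, nonpos_iff_eq_zero] at h
    refine measure_mono_null (fun x hx => ?_) h
    simp only [Set.mem_compl_iff, Set.mem_ofPred_eq] at hx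
    push Not at hx
    simp [hx.2]
  · exact Filter.Eventually.of_forall fun x h => absurd h hd

theorem ae_eventually_lt_norm_nsmul {g : ℕ → ℝ} (hg : Summable g) :
    ∀ᵐ x : UnitAddCircle, ∀ᶠ d : ℕ in Filter.atTop, g d < ‖d • x‖ := by
  have h := ae_eventually_notMem (μ := (volume : Measure UnitAddCircle))
    (s := fun d : ℕ => {x : UnitAddCircle | 0 < d ∧ ‖d • x‖ ≤ g d}) (by
      refine ne_top_of_le_ne_top ((hg.mul_left 2).tsum_ofReal_ne_top) ?_
      refine ENNReal.tsum_le_tsum fun d => ?_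
      by_cases hd : 0 < d
      · simpa only [hd, true_and] using volume_norm_nsmul_le hd (g d)
      · simp [hd])
  filter_upwards [h] with x hx
  filter_upwards [hx, Filter.eventually_gt_atTop 0] with d hd hd0
  by_contra hlt
  exact hd ⟨hd0, not_lt.1 hlt⟩

theorem le_mul_logOne (N : ℕ) : (N : ℝ) ≤ N * logOne N :=
  le_mul_of_one_le_right (Nat.cast_nonneg N) (le_max_left _ _)

theorem primeSeq_inj {m n : ℕ} (hm : 1 ≤ m) (hn : 1 ≤ n) (h : primeSeq m = primeSeq n) : m = n := by
  rw [← primeCounting_primeSeq hm, h, primeCounting_primeSeq hn]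

theorem primeSeq_mono {m n : ℕ} (h : m ≤ n) : primeSeq m ≤ primeSeq n :=
  (Nat.nth_monotone Nat.infinite_setOfPred_prime) (by omega)

theorem norm_coe_sub_mul (a b : ℕ) (hab : a ≤ b) (α : ℝ) :
    ‖((((b : ℝ) - a) * α : ℝ) : UnitAddCircle)‖ = ‖(b - a) • (α : UnitAddCircle)‖ := by
  rw [← AddCircle.coe_nsmul, nsmul_eq_mul, Nat.cast_sub hab]

theorem norm_coe_sub_mul_comm (a b α : ℝ) :
    ‖(((b - a) * α : ℝ) : UnitAddCircle)‖ = ‖(((a - b) * α : ℝ) : UnitAddCircle)‖ := by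
  rw [← norm_neg, ← AddCircle.coe_neg]
  congr 2
  ring

theorem volume_smallGapSet_eq_zero {η : ℝ → ℝ} (h_nonneg : ∀ N : ℕ, 1 ≤ N → 0 ≤ η N)
    (h_ext : ∀ x y : ℝ, 1 ≤ x → x ≤ y → η y ≤ η x)
    (hsum : Summable fun N : ℕ => η ((N : ℝ) + 1)) : volume (smallGapSet η) = 0 := by
  obtain ⟨C, hC, hCp⟩ := primeSeq_le_mul_logOne
  obtain ⟨K, hK⟩ : ∃ K : ℕ, max C 1 ≤ K := ⟨_, Nat.le_ceil _⟩
  have hK1 : (1 : ℝ) ≤ K := (le_max_right _ _).trans hK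
  have hKpos : 0 < K := by exact_mod_cast hK1
  have hCK : C ≤ K := (le_max_left _ _).trans hK
  -- The maximum keeps the argument in [1, ∞), where η is controlled, even when d / K is 0.
  set u : ℕ → ℝ := fun q => η ((max 1 q : ℕ) : ℝ) with hu
  have hu0 : ∀ q, 0 ≤ u q := fun q => h_nonneg _ (le_max_left _ _)
  have husum : Summable u := by
    rw [← summable_nat_add_iff 1]
    refine hsum.congr fun N => ?_
    simp [hu]
  have hlim : Filter.Tendsto u Filter.atTop (nhds 0) := husum.tendsto_atTop_zero
  have h1 := ae_Icc_of_ae_unitAddCircle ((ae_eventually_lt_norm_nsmul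
    (summable_comp_div hu0 husum hKpos)).and ae_nsmul_ne_zero)
  refine measure_mono_null (fun α hα => ?_) h1
  obtain ⟨hα1, hinf⟩ := hα
  simp only [Set.mem_compl_iff, Set.mem_ofPred_eq]
  intro hgood
  obtain ⟨hev, hne⟩ := hgood hα1
  obtain ⟨D, hD⟩ := Filter.eventually_atTop.1 hev
  -- Borel–Cantelli says nothing about d < D; these finitely many d have ‖dα‖ > 0, whereas η(N)
  -- tends to 0.
  have hsmall : ∀ᶠ N : ℕ in Filter.atTop, ∀ d ∈ Finset.range D, 0 < d →
      u N < ‖d • (α : UnitAddCircle)‖ := by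
    rw [Filter.eventually_all_finset]
    intro d _
    by_cases hd : 0 < d
    · filter_upwards [hlim.eventually_lt_const (norm_pos_iff.2 (hne d hd))] with N hN _
      exact hN
    · exact Filter.Eventually.of_forall fun N h => absurd h hd
  obtain ⟨N₀, hN₀⟩ := Filter.eventually_atTop.1 hsmall
  obtain ⟨N, hN, hNgt⟩ := hinf.exists_gt (max 1 N₀)
  have hN1 : 1 < N := (le_max_left _ _).trans_lt hNgt
  have hN2 : N₀ ≤ N := ((le_max_right _ _).trans_lt hNgt).le
  have hNr : (N : ℝ) ≤ N * logOne N := le_mul_logOne N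
  have hN1r : (1 : ℝ) ≤ N := by exact_mod_cast hN1.le
  obtain ⟨m, n, hm1, hmN, hn1, hnN, hmn, hle⟩ := (minGap_le_iff _ _ hN1 _).1 hN
  obtain ⟨a, b, hab, hbN, hle'⟩ : ∃ a b : ℕ, a < b ∧ b ≤ primeSeq N ∧
      ‖(b - a) • (α : UnitAddCircle)‖ ≤ η (N * logOne N) := by
    rcases lt_trichotomy (primeSeq m) (primeSeq n) with h | h | h
    · refine ⟨_, _, h, primeSeq_mono hnN, ?_⟩
      rwa [← norm_coe_sub_mul _ _ h.le, norm_coe_sub_mul_comm]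
    · exact absurd (primeSeq_inj hm1 hn1 h) hmn
    · refine ⟨_, _, h, primeSeq_mono hmN, ?_⟩
      rwa [← norm_coe_sub_mul _ _ h.le]
  have hd0 : 0 < b - a := by omega
  set d := b - a with hd
  by_cases hdD : D ≤ d
  · have h2 := hD d hdD
    have h3 : ((max 1 (d / K) : ℕ) : ℝ) ≤ N * logOne N := by
      rw [Nat.cast_max, max_le_iff]
      refine ⟨by push_cast; linarith, Nat.cast_div_le.trans ?_⟩
      rw [div_le_iff₀ (by linarith)]
      calc (d : ℝ) ≤ primeSeq N := by exact_mod_cast (by omega : d ≤ primeSeq N)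
        _ ≤ C * (N * logOne N) := hCp N hN1.le
        _ ≤ K * (N * logOne N) := by gcongr; linarith
        _ = _ := mul_comm _ _
    have h4 := h_ext _ _ (by exact_mod_cast le_max_left 1 (d / K)) h3
    exact absurd (h2.trans_le hle') (not_lt.2 h4)
  · have h2 := hN₀ N hN2 d (Finset.mem_range.2 (not_le.1 hdD)) hd0
    have h3 : u N = η N := by simp only [hu, max_eq_right hN1.le]
    rw [h3] at h2
    exact absurd (h2.trans_le hle') (not_lt.2 (h_ext _ _ hN1r hNr))

/-! ### The divergence case and the conclusion. -/

theorem volume_smallGapSet_eq_one {η : ℝ → ℝ} (h_nonneg : ∀ N : ℕ, 1 ≤ N → 0 ≤ η N)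
    (h_ext : ∀ x y : ℝ, 1 ≤ x → x ≤ y → η y ≤ η x)
    (hdiv : ¬ Summable fun N : ℕ => η ((N : ℝ) + 1)) : volume (smallGapSet η) = 1 := by
  obtain ⟨K₀, c, hc, X₀, hdens⟩ := exists_primeDifferences_density
  -- The factor 5 comes from N log N ≤ 5 p_N and K₀ from q ≤ K₀ d; adding 1 ensures K > 0.
  set K := 5 * K₀ + 1 with hK
  have hKpos : 0 < K := by omega
  set θ : ℕ → ℝ := fun d => min (η ((K * (d + 1) : ℕ) : ℝ)) (1 / 2) with hθ
  have hpos : ∀ d : ℕ, 1 ≤ K * (d + 1) := fun d => Nat.mul_pos hKpos (Nat.succ_pos d)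
  have hη0 : ∀ d : ℕ, 0 ≤ η ((K * (d + 1) : ℕ) : ℝ) := fun d => h_nonneg _ (hpos d)
  have hθ0 : ∀ d, 0 ≤ θ d := fun d => le_min (hη0 d) (by norm_num)
  have hanti : Antitone θ := by
    intro d e hde
    refine min_le_min_right _ (h_ext _ _ (by exact_mod_cast hpos d) ?_)
    exact_mod_cast Nat.mul_le_mul_left K (by omega)
  -- If ∑ θ converged, the truncation at 1/2 would eventually be inactive, and repeating each value
  -- K times would make ∑ η converge.
  have hθdiv : ¬ Summable θ := by
    intro hs
    have hev : ∀ᶠ d in Filter.atTop, θ d = η ((K * (d + 1) : ℕ) : ℝ) := by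
      filter_upwards [hs.tendsto_atTop_zero.eventually_lt_const
        (by norm_num : (0 : ℝ) < 1 / 2)] with d hd
      rcases min_choice (η ((K * (d + 1) : ℕ) : ℝ)) (1 / 2) with h | h
      · exact h
      · rw [hθ] at hd
        simp only [h, lt_irrefl] at hd
    have hs' : Summable fun d : ℕ => η ((K * (d + 1) : ℕ) : ℝ) :=
      hs.congr_atTop hev
    have hs2 := summable_comp_div hη0 hs' hKpos
    apply hdiv
    have hs3 : Summable fun n : ℕ => η (((n + K : ℕ) : ℝ) + 1) := by
      refine Summable.of_nonneg_of_le (fun n => ?_) (fun n => ?_) hs2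
      · exact_mod_cast h_nonneg (n + K + 1) (by omega)
      · refine h_ext _ _ (by exact_mod_cast hpos _) ?_
        have : K * (n / K + 1) ≤ n + K := by
          rw [mul_add, mul_one]
          exact Nat.add_le_add_right (Nat.mul_div_le n K) K
        have h : ((K * (n / K + 1) : ℕ) : ℝ) ≤ ((n + K : ℕ) : ℝ) := by exact_mod_cast this
        linarith
    exact (summable_nat_add_iff (f := fun n : ℕ => η ((n : ℝ) + 1)) K).1 hs3
  have hGdiv := not_summable_indicator_of_density hanti hθ0 hθdiv (primeDifferences K₀) hc X₀ hdens
  have hae := ae_Icc_of_ae_unitAddCircle (ae_infinite_norm_nsmul_lt (K := (K₀ : ℝ) + 1)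
    (by positivity) (primeDifferences K₀) (fun d hd => hd.1)
    (fun d hd => hd.2.1.trans (by linarith)) θ hθ0 (fun d => min_le_right _ _) hGdiv)
  have hset : smallGapSet η =ᵐ[volume] Set.Icc (0 : ℝ) 1 := by
    filter_upwards [hae] with α hα
    refine propext ⟨fun h => h.1, fun h => ⟨h, ?_⟩⟩
    rw [Set.infinite_iff_exists_gt]
    intro M
    -- Taking d > p_M forces q > p_M, so that the index N of q exceeds M.
    obtain ⟨d, ⟨hdG, hdθ⟩, hdM⟩ := (hα h).exists_gt (primeSeq M)
    obtain ⟨hd1, -, p, q, hp, hq, hqp, hqK⟩ := hdG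
    set N := Nat.primeCounting q with hN
    set m := Nat.primeCounting p with hm
    have hpN : primeSeq N = q := primeSeq_primeCounting hq
    have hpm : primeSeq m = p := primeSeq_primeCounting hp
    have hm1 : 1 ≤ m := Nat.one_le_iff_ne_zero.2 fun h0 => by
      have := Nat.primeCounting_eq_zero_iff.1 h0
      have := hp.two_le
      omega
    have hmN : m < N := by
      by_contra hlt
      have := primeSeq_mono (not_lt.1 hlt)
      omega
    have hMN : M < N := by
      by_contra hlt
      have := primeSeq_mono (not_lt.1 hlt)
      omega
    refine ⟨N, ?_, hMN⟩
    have hN1 : 1 ≤ N := by omega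
    have hle : (N : ℝ) * logOne N ≤ ((K * (d + 1) : ℕ) : ℝ) := by
      have h5 := mul_logOne_le_primeSeq hN1
      rw [hpN] at h5
      refine h5.trans ?_
      have : 5 * q ≤ K * (d + 1) := by rw [hK]; nlinarith
      exact_mod_cast this
    have h1N : (1 : ℝ) ≤ N * logOne N :=
      le_trans (by exact_mod_cast hN1) (le_mul_logOne N)
    refine (minGap_le_iff _ _ (by omega) _).2
      ⟨N, m, hN1, le_rfl, hm1, hmN.le, hmN.ne', ?_⟩
    rw [hpN, hpm, norm_coe_sub_mul _ _ (by omega), show q - p = d by omega]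
    exact hdθ.le.trans ((min_le_left _ _).trans (h_ext _ _ h1N hle))
  rw [measure_congr hset]
  simp

theorem theorem4 (η : ℝ → ℝ)
    (h_nonneg : ∀ N : ℕ, 1 ≤ N → 0 ≤ η (N : ℝ))
    (h_strict : ∀ M N : ℕ, 1 ≤ M → M < N → η (N : ℝ) < η (M : ℝ))
    (h_ext : ∀ x y : ℝ, 1 ≤ x → x ≤ y → η y ≤ η x)
    (h_doubling : ∃ c : ℝ, 0 < c ∧ ∀ N : ℕ, 1 ≤ N → c ≤ η (2 * (N : ℝ)) / η (N : ℝ)) :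
    MeasurableSet (smallGapSet η) ∧
    (Summable (fun N : ℕ => η ((N : ℝ) + 1)) → volume (smallGapSet η) = 0) ∧
    (¬ Summable (fun N : ℕ => η ((N : ℝ) + 1)) → volume (smallGapSet η) = 1) :=
  ⟨measurableSet_smallGapSet η, volume_smallGapSet_eq_zero h_nonneg h_ext,
    volume_smallGapSet_eq_one h_nonneg h_ext⟩
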